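/- Let $q\ge 2$ be an integer, let $X$ be the homogeneous tree of degree $q+1$ (the infinite tree in which every vertex has exactly $q+1$ neighbours), fix a vertex $o\in X$, and let $|x|$ be the graph distance from $o$ to $x$. Let $\Delta f(x)=f(x)-\frac1{q+1}\sum_{y\sim x}f(y)$ be the nearest-neighbour Laplacian, a bounded operator on $\ell^2(X)$, and let $h_u(x)=(e^{-u\Delta}\delta_o)(x)$, $u>0$, be its heat kernel. Let $0<\alpha<2$. For $t>0$ let $\eta_t\ge 0$ be the density on $(0,\infty)$ determined (up to null sets) by $$\int_0^\infty e^{-\lambda u}\eta_t(u)\,du=e^{-t\lambda^{\alpha/2}},\qquad \lambda\ge 0,$$ and let $$p_t(x)=\int_0^\infty h_u(x)\,\eta_t(u)\,du ,\qquad x\in X,$$ be the $\alpha$-stable kernel. For $0<A_1<A_2$ and $t>0$ put $$R(t)=R_{A_1,A_2}(t)=\{x\in X: A_1t^{2/\alpha}\le |x|\le A_2t^{2/\alpha}\}.$$ (i) For all $0<A_1<A_2$ there exist constants $0<c_1<c_2<1$ such that $$c_1<\sum_{x\in R(t)}p_t(x)<c_2\qquad\text{for all sufficiently large } t. \tag{$*$}$$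 (ii) For every $c_1\in(0,1)$ there exist $0<A_1<A_2$ such that $(*)$ holds with this $c_1$ and some $c_2\in(c_1,1)$. (iii) For every $c_2\in(0,1)$ there exist $0<A_1<A_2$ such that $(*)$ holds with this $c_2$ and some $c_1\in(0,c_2)$. -/

import Mathlib

open Set Filter Topology MeasureTheory

/-- The Hilbert space `ℓ²(V)` of square summable real functions on the vertices. -/
abbrev VertexL2 (V : Type*) : Type _ := lp (fun _ : V => ℝ) 2

section Averaging

variable {V : Type*} (G : SimpleGraph V) [G.LocallyFinite] (q : ℕ)

/-- The average of `f` over the `q + 1` neighbours of `x`: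
`(1 / (q + 1)) ∑_{y ∼ x} f y`. -/
noncomputable def neighborMean (f : V → ℝ) (x : V) : ℝ :=
  (1 / ((q : ℝ) + 1)) * ∑ y ∈ G.neighborFinset x, f y

variable {G q}

/-- Square summability bound for neighbour averages on a regular graph. -/
theorem sum_sq_neighborMean_le (hG : G.IsRegularOfDegree (q + 1)) (f : VertexL2 V)
    (s : Finset V) :
    ∑ x ∈ s, ‖neighborMean G q f x‖ ^ (2 : ENNReal).toReal ≤ ‖f‖ ^ (2 : ENNReal).toReal := by
  classical
  have hq : (0 : ℝ) < (q : ℝ) + 1 := by positivity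
  have hcard : ∀ x, (G.neighborFinset x).card = q + 1 := fun x => by
    rw [SimpleGraph.card_neighborFinset_eq_degree]; exact hG x
  have hpt : ∀ x, ‖neighborMean G q f x‖ ^ (2 : ENNReal).toReal
      ≤ (1 / ((q : ℝ) + 1)) * ∑ y ∈ G.neighborFinset x, (f y) ^ 2 := by
    intro x
    have h := sq_sum_le_card_mul_sum_sq (s := G.neighborFinset x) (f := fun y => f y)
    rw [hcard x] at h
    push_cast at h
    simp only [ENNReal.toReal_ofNat, Real.rpow_ofNat, Real.norm_eq_abs, sq_abs, neighborMean]
    rw [mul_pow]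
    calc (1 / ((q : ℝ) + 1)) ^ 2 * (∑ y ∈ G.neighborFinset x, f y) ^ 2
        ≤ (1 / ((q : ℝ) + 1)) ^ 2 *
          (((q : ℝ) + 1) * ∑ y ∈ G.neighborFinset x, (f y) ^ 2) := by gcongr
      _ = _ := by field_simp
  have hswap : ∑ x ∈ s, ∑ y ∈ G.neighborFinset x, (f y) ^ 2
      = ∑ y ∈ s.biUnion (fun x => G.neighborFinset x),
          ∑ x ∈ s ∩ G.neighborFinset y, (f y) ^ 2 := by
    refine Finset.sum_comm' fun x y => ?_
    simp only [Finset.mem_biUnion, Finset.mem_inter, SimpleGraph.mem_neighborFinset]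
    constructor
    · rintro ⟨hx, hxy⟩
      exact ⟨⟨hx, hxy.symm⟩, x, hx, hxy⟩
    · rintro ⟨⟨hx, hyx⟩, -⟩
      exact ⟨hx, hyx.symm⟩
  have hle : ∑ x ∈ s, ∑ y ∈ G.neighborFinset x, (f y) ^ 2
      ≤ ((q : ℝ) + 1) * ‖f‖ ^ (2 : ENNReal).toReal := by
    rw [hswap]
    calc _ ≤ ∑ y ∈ s.biUnion (fun x => G.neighborFinset x), ((q : ℝ) + 1) * (f y) ^ 2 := by
          refine Finset.sum_le_sum fun y _ => ?_
          rw [Finset.sum_const, nsmul_eq_mul]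
          have : ((s ∩ G.neighborFinset y).card : ℝ) ≤ (q : ℝ) + 1 := by
            have := Finset.card_le_card
              (Finset.inter_subset_right (s₁ := s) (s₂ := G.neighborFinset y))
            rw [hcard y] at this
            exact_mod_cast this
          gcongr
      _ ≤ _ := by
          rw [← Finset.mul_sum]
          have := lp.sum_rpow_le_norm_rpow (p := 2) (by norm_num) f
            (s.biUnion (fun x => G.neighborFinset x))
          gcongr
          simpa using this
  calc _ ≤ ∑ x ∈ s, (1 / ((q : ℝ) + 1)) * ∑ y ∈ G.neighborFinset x, (f y) ^ 2 :=
        Finset.sum_le_sum fun x _ => hpt x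
    _ ≤ (1 / ((q : ℝ) + 1)) * (((q : ℝ) + 1) * ‖f‖ ^ (2 : ENNReal).toReal) := by
        rw [← Finset.mul_sum]; gcongr
    _ = _ := by field_simp

/-- Averaging over neighbours, as a bounded operator on `ℓ²(V)`. -/
noncomputable def averagingOperator (hG : G.IsRegularOfDegree (q + 1)) :
    VertexL2 V →L[ℝ] VertexL2 V :=
  LinearMap.mkContinuous
    { toFun := fun f => ⟨neighborMean G q f, memℓp_gen' (sum_sq_neighborMean_le hG f)⟩
      map_add' := fun f g => by
        ext x
        change neighborMean G q (fun y => f y + g y) x = neighborMean G q f x + neighborMean G q g x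
        simp only [neighborMean, Finset.sum_add_distrib, mul_add]
      map_smul' := fun c f => by
        ext x
        simp only [neighborMean, lp.coeFn_smul, Pi.smul_apply, smul_eq_mul, RingHom.id_apply,
          ← Finset.mul_sum]
        ring }
    1
    (fun f => by
      rw [one_mul]
      exact lp.norm_le_of_forall_sum_le (by norm_num) (norm_nonneg f)
        (sum_sq_neighborMean_le hG f))

/-- The nearest-neighbour Laplacian `Δ f (x) = f x - (1 / (q + 1)) ∑_{y ∼ x} f y`
as a bounded operator on `ℓ²(V)`. -/
noncomputable def graphLaplacian (hG : G.IsRegularOfDegree (q + 1)) :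
    VertexL2 V →L[ℝ] VertexL2 V :=
  ContinuousLinearMap.id ℝ (VertexL2 V) - averagingOperator hG

theorem graphLaplacian_apply (hG : G.IsRegularOfDegree (q + 1)) (f : VertexL2 V) (x : V) :
    graphLaplacian hG f x = f x - (1 / ((q : ℝ) + 1)) * ∑ y ∈ G.neighborFinset x, f y :=
  rfl

/-- The heat semigroup `H_t = e^{-tΔ}`, the exponential of a bounded operator. -/
noncomputable def heatSemigroup (hG : G.IsRegularOfDegree (q + 1)) (t : ℝ) :
    VertexL2 V →L[ℝ] VertexL2 V :=
  NormedSpace.exp ((-t) • graphLaplacian hG)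

open Classical in
/-- The heat kernel with pole `o`: `h_t(x) = (e^{-tΔ} δ_o)(x)`. -/
noncomputable def heatKernel (hG : G.IsRegularOfDegree (q + 1)) (o : V) (t : ℝ) (x : V) : ℝ :=
  heatSemigroup hG t (lp.single 2 o (1 : ℝ)) x

end Averaging

/-- `f` is a density on `(0, ∞)` of the `α/2`-stable subordinator at time `t`: its Laplace
transform is `λ ↦ exp (-t λ^{α/2})`. This determines `f` almost everywhere on `(0, ∞)`. -/
structure IsSubordinatorDensity (α t : ℝ) (f : ℝ → ℝ) : Prop where
  nonneg : ∀ u, 0 < u → 0 ≤ f u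
  integrableOn : IntegrableOn f (Ioi 0)
  laplace : ∀ l : ℝ, 0 ≤ l →
    ∫ u in Ioi (0 : ℝ), Real.exp (-(l * u)) * f u = Real.exp (-(t * l ^ (α / 2)))

open Classical in
/-- The subordinator density `η_t(u)`, determined (up to a null set) by its Laplace transform. -/
noncomputable def subordinatorDensity (α t : ℝ) : ℝ → ℝ :=
  if h : ∃ f : ℝ → ℝ, IsSubordinatorDensity α t f then h.choose else 0

section Stable

variable {V : Type*} {G : SimpleGraph V} [G.LocallyFinite] {q : ℕ}

/-- The `α`-stable kernel `p_t(x) = ∫_0^∞ h_u(x) η_t(u) du` with pole `o`. -/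
noncomputable def stableKernel (hG : G.IsRegularOfDegree (q + 1)) (α : ℝ) (o : V) (t : ℝ)
    (x : V) : ℝ :=
  ∫ u in Ioi (0 : ℝ), heatKernel hG o u x * subordinatorDensity α t u

/-- The annulus `{x : A₁ t^{2/α} ≤ |x| ≤ A₂ t^{2/α}}`, where `|x|` is the graph distance
from `x` to `o`. -/
def annulus (G : SimpleGraph V) (α : ℝ) (o : V) (A₁ A₂ t : ℝ) : Set V :=
  {x | A₁ * t ^ (2 / α) ≤ (G.dist o x : ℝ) ∧ (G.dist o x : ℝ) ≤ A₂ * t ^ (2 / α)}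

/-- The `p_t`-mass of the annulus (a finite set of vertices when `G` is connected). -/
noncomputable def annulusMass (hG : G.IsRegularOfDegree (q + 1)) (α : ℝ) (o : V)
    (A₁ A₂ t : ℝ) : ℝ :=
  ∑' x : annulus G α o A₁ A₂ t, stableKernel hG α o t x

end Stable

/-! Write `b = α / 2`, `T = t ^ (2 / α)`, `v = walkSpeed q`. The heat kernel at time `u` is the law
of a simple random walk after a Poisson(`u`) number of steps. Away from `o` each vertex has one
neighbour nearer to `o` and `q` farther, so the distance from `o` grows with speed `v`; its second
moment about `v u` is at most `4 u`, so it equals `v u` up to `O(√u)`.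

Stable densities are self-similar, `η_t(u) = T⁻¹ η_1(u / T)` almost everywhere, so the annulus mass
is the average against `η_1(s) ds` of the heat mass of the annulus at time `T s`. By Chebyshev that
heat mass tends to `1` if `A₁ < v s < A₂` and to `0` if `v s` lies outside `[A₁, A₂]`. Dominated
convergence gives the limit `∫ η_1` over `(A₁ / v, A₂ / v)` (`tendsto_annulusMass`). All three
claims follow once `η_1` is known to be a probability density that charges every interval of `(0,
∞)`.

Existence: the inverse Fourier transform of `exp (-(i y) ^ b)` has the right Laplace transform by
Cauchy's theorem, and is nonnegative because `exp (-l ^ b)` is completely monotone. Uniqueness comes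
from analytic continuation of moment generating functions. Full support: differentiating the Laplace
transform gives `u η_1(u) = (η_1 * k)(u)` with `k` a positive multiple of `u ^ (-b)`. A gap `(a, c)`
in `η_1` would then push its whole mass into `[c, ∞)`, so that `exp (-l ^ b) ≤ exp (-l c)` for all
`l > 0`, which is false for large `l`. -/

/-! ### The averaging operator as a Markov operator -/

section RandomWalk

variable {V : Type*} {G : SimpleGraph V} [G.LocallyFinite] {q : ℕ}

variable (G q) in
/-- Averaging over neighbours, as a linear map on all functions. -/
noncomputable def neighborMeanLin : (V → ℝ) →ₗ[ℝ] (V → ℝ) where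
  toFun f := neighborMean G q f
  map_add' f g := by
    ext x
    simp only [neighborMean, Pi.add_apply, Finset.sum_add_distrib, mul_add]
  map_smul' c f := by
    ext x
    simp only [neighborMean, Pi.smul_apply, smul_eq_mul, RingHom.id_apply, ← Finset.mul_sum]
    ring

theorem neighborMeanLin_apply (f : V → ℝ) (x : V) :
    neighborMeanLin G q f x = (1 / ((q : ℝ) + 1)) * ∑ y ∈ G.neighborFinset x, f y := rfl

theorem neighborMeanLin_mono {f g : V → ℝ} (h : f ≤ g) :
    neighborMeanLin G q f ≤ neighborMeanLin G q g := by
  intro x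
  rw [neighborMeanLin_apply, neighborMeanLin_apply]
  gcongr with y
  exact h y

theorem neighborMeanLin_pow_mono (n : ℕ) {f g : V → ℝ} (h : f ≤ g) :
    (neighborMeanLin G q ^ n) f ≤ (neighborMeanLin G q ^ n) g := by
  induction n generalizing f g with
  | zero => simpa using h
  | succ n ih =>
    rw [pow_succ]
    exact ih (neighborMeanLin_mono h)

theorem neighborMeanLin_one (hG : G.IsRegularOfDegree (q + 1)) :
    neighborMeanLin G q (fun _ => 1) = fun _ => 1 := by
  ext x
  rw [neighborMeanLin_apply, Finset.sum_const, SimpleGraph.card_neighborFinset_eq_degree, hG x]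
  have : (q : ℝ) + 1 ≠ 0 := by positivity
  simp only [nsmul_eq_mul, mul_one, Nat.cast_add, Nat.cast_one]
  field_simp

theorem neighborMeanLin_pow_one (hG : G.IsRegularOfDegree (q + 1)) (n : ℕ) :
    (neighborMeanLin G q ^ n) (fun _ => 1) = fun _ => 1 := by
  induction n with
  | zero => simp
  | succ n ih =>
    rw [pow_succ, Module.End.mul_apply, neighborMeanLin_one hG, ih]

-- Reversibility of the walk: peel the first step on one side and the last on the other. It moves
-- the pole from the function to the evaluation point, so that summing over target vertices yields
-- the iterate of an indicator, to which monotonicity applies.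
open Classical in
theorem neighborMeanLin_pow_single_symm (n : ℕ) (x y : V) :
    (neighborMeanLin G q ^ n) (Pi.single y 1) x = (neighborMeanLin G q ^ n) (Pi.single x 1) y := by
  induction n generalizing x y with
  | zero => simp [Pi.single_apply, eq_comm]
  | succ n ih =>
    have h1 : neighborMeanLin G q (Pi.single x 1)
        = (1 / ((q : ℝ) + 1)) • ∑ z ∈ G.neighborFinset x, Pi.single z (1 : ℝ) := by
      ext w
      rw [neighborMeanLin_apply]
      simp only [Pi.smul_apply, Finset.sum_apply, Pi.single_apply, smul_eq_mul,
        Finset.sum_ite_eq, Finset.sum_ite_eq', SimpleGraph.mem_neighborFinset, G.adj_comm]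
    conv_lhs => rw [pow_succ', Module.End.mul_apply, neighborMeanLin_apply]
    conv_rhs => rw [pow_succ, Module.End.mul_apply, h1, map_smul, map_sum]
    rw [Pi.smul_apply, Finset.sum_apply, smul_eq_mul]
    congr 1
    exact Finset.sum_congr rfl fun z _ => ih z y

end RandomWalk

/-! ### Drift and second moment of the distance on a tree -/

section Tree

variable {V : Type*} {G : SimpleGraph V}

/-- The penultimate vertex of a geodesic works. A geodesic to any nearer neighbour, prolonged by the
edge to `x`, is again a path from `o` to `x`, and paths in a tree are unique. -/
theorem SimpleGraph.IsTree.existsUnique_adj_dist (hT : G.IsTree) {o x : V} (hx : x ≠ o) :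
    ∃! y, G.Adj x y ∧ G.dist o x = G.dist o y + 1 := by
  obtain ⟨p, hp, hl⟩ := hT.connected.exists_path_of_dist o x
  have hnil : ¬ p.Nil := SimpleGraph.Walk.not_nil_of_ne hx.symm
  have hadj := p.adj_penultimate hnil
  refine ⟨p.penultimate, ⟨hadj.symm, ?_⟩, ?_⟩
  · rcases hT.dist_eq_dist_add_one_of_adj o hadj with h | h
    · have h1 : G.dist o p.penultimate ≤ p.dropLast.length := SimpleGraph.dist_le _
      have h2 : p.dropLast.length + 1 = p.length := SimpleGraph.Walk.length_dropLast_add_one hnil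
      omega
    · exact h
  · rintro y ⟨hy, hd⟩
    obtain ⟨r, hr, hrl⟩ := hT.connected.exists_path_of_dist o y
    have hc : (r.concat hy.symm).IsPath := by
      apply SimpleGraph.Walk.isPath_of_length_eq_dist
      rw [SimpleGraph.Walk.length_concat, hrl, hd]
    have := (hT.isAcyclic.subsingleton_path o x).elim ⟨p, hp⟩ ⟨_, hc⟩
    have h3 : p = r.concat hy.symm := congrArg Subtype.val this
    rw [h3]
    simp

variable [G.LocallyFinite] {q : ℕ}

theorem SimpleGraph.IsTree.sum_neighborFinset_dist (hT : G.IsTree)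
    (hG : G.IsRegularOfDegree (q + 1)) {o x : V} (hx : x ≠ o) (φ : ℝ → ℝ) :
    ∑ y ∈ G.neighborFinset x, φ (G.dist o y)
      = φ ((G.dist o x : ℝ) - 1) + q * φ ((G.dist o x : ℝ) + 1) := by
  classical
  obtain ⟨y₀, ⟨hadj, hd⟩, huniq⟩ := hT.existsUnique_adj_dist hx
  have hmem : y₀ ∈ G.neighborFinset x := by simpa using hadj
  rw [← Finset.add_sum_erase _ _ hmem]
  congr 1
  · rw [hd]; simp
  · rw [Finset.sum_congr rfl (g := fun _ => φ ((G.dist o x : ℝ) + 1)), Finset.sum_const,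
      Finset.card_erase_of_mem hmem, SimpleGraph.card_neighborFinset_eq_degree, hG x]
    · simp
    · intro y hy
      rw [Finset.mem_erase, SimpleGraph.mem_neighborFinset] at hy
      rcases hT.dist_eq_dist_add_one_of_adj o hy.2 with h | h
      · exact absurd (huniq y ⟨hy.2, h⟩) hy.1
      · rw [h]; simp

/-- The speed `(q - 1) / (q + 1)` of the simple random walk on the `(q + 1)`-regular tree. -/
noncomputable def walkSpeed (q : ℕ) : ℝ := ((q : ℝ) - 1) / ((q : ℝ) + 1)

theorem walkSpeed_pos (hq : 2 ≤ q) : 0 < walkSpeed q := by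
  have : (2 : ℝ) ≤ q := by exact_mod_cast hq
  unfold walkSpeed
  apply div_pos <;> linarith

theorem walkSpeed_le_one : walkSpeed q ≤ 1 := by
  unfold walkSpeed
  rw [div_le_one (by positivity)]
  linarith

/-- Away from `o`, a step changes the distance with mean `v` and variance `1 - v ^ 2`. At `o` the
step is surely outward, and the surplus `1 - v` only brings the walk closer to `v (m + 1)`, up to
the allowed error `1`. -/
theorem neighborMeanLin_sq_dist_le (hq : 2 ≤ q) (hT : G.IsTree)
    (hG : G.IsRegularOfDegree (q + 1)) (o x : V) {m : ℝ} (hm : 0 ≤ m) :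
    neighborMeanLin G q (fun y => ((G.dist o y : ℝ) - walkSpeed q * (m + 1)) ^ 2) x
      ≤ ((G.dist o x : ℝ) - walkSpeed q * m) ^ 2 + 1 := by
  have hv := walkSpeed_pos hq
  have hv1 := walkSpeed_le_one (q := q)
  have hq0 : (q : ℝ) + 1 ≠ 0 := by positivity
  rw [neighborMeanLin_apply]
  by_cases hx : x = o
  · subst hx
    have : ∀ y ∈ G.neighborFinset x, ((G.dist x y : ℝ) - walkSpeed q * (m + 1)) ^ 2
        = (1 - walkSpeed q * (m + 1)) ^ 2 := by
      intro y hy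
      rw [SimpleGraph.mem_neighborFinset] at hy
      rw [SimpleGraph.dist_eq_one_iff_adj.mpr hy, Nat.cast_one]
    rw [Finset.sum_congr rfl this, Finset.sum_const, SimpleGraph.card_neighborFinset_eq_degree,
      hG x, nsmul_eq_mul, SimpleGraph.dist_self]
    push_cast
    rw [← mul_assoc, one_div_mul_cancel hq0, one_mul]
    nlinarith [mul_nonneg (mul_nonneg hv.le hm) (sub_nonneg.mpr hv1)]
  · rw [hT.sum_neighborFinset_dist hG hx (fun r => (r - walkSpeed q * (m + 1)) ^ 2)]
    have key : walkSpeed q * (q + 1) = q - 1 := by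
      unfold walkSpeed; field_simp
    set d : ℝ := (G.dist o x : ℝ)
    set v := walkSpeed q
    have hpos : (0 : ℝ) < q + 1 := by positivity
    rw [one_div, inv_mul_le_iff₀ hpos]
    -- The cross term carries the factor `v (q + 1) - (q - 1)`, which vanishes for this speed.
    have : ((q : ℝ) + 1) * ((d - v * m) ^ 2 + 1)
        - ((d - 1 - v * (m + 1)) ^ 2 + q * (d + 1 - v * (m + 1)) ^ 2)
        = v ^ 2 * (q + 1) + 2 * (d - v * m - v) * (v * (q + 1) - (q - 1)) := by ring
    rw [key, sub_self, mul_zero, add_zero] at this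
    nlinarith [mul_nonneg (sq_nonneg v) hpos.le]

theorem neighborMeanLin_pow_sq_dist_le (hq : 2 ≤ q) (hT : G.IsTree)
    (hG : G.IsRegularOfDegree (q + 1)) (o x : V) (n : ℕ) {m : ℝ} (hm : 0 ≤ m) :
    (neighborMeanLin G q ^ n) (fun y => ((G.dist o y : ℝ) - walkSpeed q * (m + n)) ^ 2) x
      ≤ ((G.dist o x : ℝ) - walkSpeed q * m) ^ 2 + n := by
  induction n with
  | zero => simp
  | succ n ih =>
    have h1 : neighborMeanLin G q
          (fun y => ((G.dist o y : ℝ) - walkSpeed q * (m + (n + 1 : ℕ))) ^ 2)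
        ≤ (fun y => ((G.dist o y : ℝ) - walkSpeed q * (m + n)) ^ 2) + fun _ => 1 := by
      intro y
      have := neighborMeanLin_sq_dist_le hq hT hG o y (m := m + n) (by positivity)
      push_cast
      rwa [← add_assoc]
    have h2 := neighborMeanLin_pow_mono (G := G) (q := q) n h1 x
    rw [map_add, Pi.add_apply, neighborMeanLin_pow_one hG] at h2
    rw [pow_succ, Module.End.mul_apply]
    push_cast at h2 ⊢
    linarith

/-- Second moment of the displacement of the walk after `n` steps about `v u`. -/
theorem neighborMeanLin_pow_sq_dist_sub_le (hq : 2 ≤ q) (hT : G.IsTree)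
    (hG : G.IsRegularOfDegree (q + 1)) (o : V) (n : ℕ) (u : ℝ) :
    (neighborMeanLin G q ^ n) (fun y => ((G.dist o y : ℝ) - walkSpeed q * u) ^ 2) o
      ≤ 2 * n + 2 * (n - u) ^ 2 := by
  have hv := walkSpeed_pos hq
  have hv1 := walkSpeed_le_one (q := q)
  -- Split at `v n` with `(a + b) ^ 2 ≤ 2 a ^ 2 + 2 b ^ 2`, then use `v ≤ 1`.
  have h1 : (fun y => ((G.dist o y : ℝ) - walkSpeed q * u) ^ 2)
      ≤ (2 : ℝ) • (fun y => ((G.dist o y : ℝ) - walkSpeed q * (0 + n)) ^ 2)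
        + (2 * (n - u) ^ 2) • fun _ => (1 : ℝ) := by
    intro y
    simp only [Pi.add_apply, Pi.smul_apply, smul_eq_mul, mul_one]
    have : (walkSpeed q * (n - u)) ^ 2 ≤ (n - u) ^ 2 := by
      rw [mul_pow]
      exact mul_le_of_le_one_left (sq_nonneg _) (pow_le_one₀ hv.le hv1)
    nlinarith [sq_nonneg ((G.dist o y : ℝ) - walkSpeed q * (0 + n) - walkSpeed q * (n - u))]
  have h2 := neighborMeanLin_pow_mono (G := G) (q := q) n h1 o
  rw [map_add, map_smul, map_smul, neighborMeanLin_pow_one hG] at h2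
  have h3 := neighborMeanLin_pow_sq_dist_le hq hT hG o o n (m := 0) le_rfl
  simp only [Pi.add_apply, Pi.smul_apply, smul_eq_mul, mul_one] at h2
  simp at h3 h2
  linarith

theorem finite_setOf_dist_le (hC : G.Connected) (o : V) (r : ℕ) :
    {x | G.dist o x ≤ r}.Finite := by
  classical
  induction r with
  | zero =>
    refine (Set.finite_singleton o).subset fun x hx => ?_
    have : G.dist o x = 0 := Nat.le_zero.mp hx
    exact ((hC.dist_eq_zero_iff).mp this).symm
  | succ r ih =>
    refine (ih.union (ih.biUnion fun y _ => (G.neighborFinset y).finite_toSet)).subset ?_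
    intro x hx
    by_cases h : G.dist o x ≤ r
    · exact Or.inl h
    · right
      obtain ⟨p, hp, hl⟩ := hC.exists_path_of_dist o x
      have hnil : ¬ p.Nil := by
        intro hn
        have := SimpleGraph.Walk.length_eq_zero_iff.mpr hn
        omega
      have h1 : G.dist o p.penultimate ≤ p.dropLast.length := SimpleGraph.dist_le _
      have h2 : p.dropLast.length + 1 = p.length := SimpleGraph.Walk.length_dropLast_add_one hnil
      have hx' : G.dist o x ≤ r + 1 := hx
      refine Set.mem_biUnion (x := p.penultimate) (show G.dist o p.penultimate ≤ r by omega) ?_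
      simpa using p.adj_penultimate hnil

end Tree

/-! ### Moments of the Poisson distribution -/

section Poisson

theorem hasSum_pow_div_factorial (u : ℝ) :
    HasSum (fun n : ℕ => u ^ n / n.factorial) (Real.exp u) := by
  have := NormedSpace.expSeries_div_hasSum_exp u
  rwa [← Real.exp_eq_exp_ℝ] at this

theorem hasSum_mul_pow_div_factorial (u : ℝ) :
    HasSum (fun n : ℕ => (n : ℝ) * (u ^ n / n.factorial)) (u * Real.exp u) := by
  refine (hasSum_nat_add_iff' 1).mp ?_
  simp only [Finset.range_one, Finset.sum_singleton, Nat.cast_zero, zero_mul, sub_zero]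
  refine ((hasSum_pow_div_factorial u).mul_left u).congr_fun fun n => ?_
  rw [Nat.factorial_succ]
  push_cast
  field_simp
  ring

theorem hasSum_sq_mul_pow_div_factorial (u : ℝ) :
    HasSum (fun n : ℕ => (n : ℝ) ^ 2 * (u ^ n / n.factorial)) ((u ^ 2 + u) * Real.exp u) := by
  refine (hasSum_nat_add_iff' 1).mp ?_
  have h := ((hasSum_mul_pow_div_factorial u).mul_left u).add
    ((hasSum_pow_div_factorial u).mul_left u)
  have e : (u ^ 2 + u) * Real.exp u
      - ∑ i ∈ Finset.range 1, (i : ℝ) ^ 2 * (u ^ i / i.factorial)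
      = u * (u * Real.exp u) + u * Real.exp u := by
    simp only [Finset.range_one, Finset.sum_singleton, Nat.cast_zero]
    ring
  rw [e]
  refine h.congr_fun fun n => ?_
  rw [Nat.factorial_succ]
  push_cast
  field_simp
  ring

/-- A Poisson variable has mean and variance both `u`, whence `2 u + 2 u`. The weight is the bound
of `neighborMeanLin_pow_sq_dist_sub_le`. -/
theorem hasSum_poisson_second_moment (u : ℝ) :
    HasSum (fun n : ℕ => Real.exp (-u) * (u ^ n / n.factorial) * (2 * n + 2 * (n - u) ^ 2))
      (4 * u) := by
  have h := ((((hasSum_mul_pow_div_factorial u).mul_left (2 - 4 * u)).add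
    ((hasSum_sq_mul_pow_div_factorial u).mul_left 2)).add
    ((hasSum_pow_div_factorial u).mul_left (2 * u ^ 2))).mul_left (Real.exp (-u))
  have e : Real.exp (-u) * ((2 - 4 * u) * (u * Real.exp u) + 2 * ((u ^ 2 + u) * Real.exp u)
      + 2 * u ^ 2 * Real.exp u) = 4 * u := by
    have : Real.exp (-u) * Real.exp u = 1 := by rw [← Real.exp_add]; simp
    linear_combination (4 * u) * this
  rw [e] at h
  exact h.congr_fun fun n => by ring

theorem hasSum_poisson (u : ℝ) :
    HasSum (fun n : ℕ => Real.exp (-u) * (u ^ n / n.factorial)) 1 := by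
  have := (hasSum_pow_div_factorial u).mul_left (Real.exp (-u))
  rwa [← Real.exp_add, neg_add_cancel, Real.exp_zero] at this

end Poisson

/-! ### The heat kernel as a Poissonised random walk -/

section HeatKernel

variable {V : Type*} {G : SimpleGraph V} [G.LocallyFinite] {q : ℕ}

theorem averagingOperator_pow_apply (hG : G.IsRegularOfDegree (q + 1)) (n : ℕ) (f : VertexL2 V) :
    ⇑((averagingOperator hG ^ n) f) = (neighborMeanLin G q ^ n) f := by
  induction n with
  | zero => rfl
  | succ n ih =>
    rw [pow_succ', pow_succ', Module.End.mul_apply, ← ih]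
    rfl

/-- The identity part of the Laplacian commutes with averaging; splitting it off produces the factor
of the Poisson weights. -/
theorem heatSemigroup_eq (hG : G.IsRegularOfDegree (q + 1)) (u : ℝ) :
    heatSemigroup hG u = Real.exp (-u) • NormedSpace.exp (u • averagingOperator hG) := by
  let _ : NormedAlgebra ℚ (VertexL2 V →L[ℝ] VertexL2 V) := NormedAlgebra.restrictScalars ℚ ℝ _
  have h : (-u) • graphLaplacian hG
      = algebraMap ℝ (VertexL2 V →L[ℝ] VertexL2 V) (-u) + u • averagingOperator hG := by
    rw [graphLaplacian, Algebra.algebraMap_eq_smul_one, smul_sub, sub_eq_add_neg, neg_smul u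
      (averagingOperator hG), neg_neg]
    rfl
  rw [heatSemigroup, h, NormedSpace.exp_add_of_commute (Algebra.commutes _ _),
    ← NormedSpace.algebraMap_exp_comm, ← Real.exp_eq_exp_ℝ, ← Algebra.smul_def]

open Classical in
theorem hasSum_heatKernel (hG : G.IsRegularOfDegree (q + 1)) (o : V) (u : ℝ) (x : V) :
    HasSum (fun n : ℕ => Real.exp (-u) * (u ^ n / n.factorial) *
      (neighborMeanLin G q ^ n) (Pi.single x 1) o) (heatKernel hG o u x) := by
  have h := NormedSpace.exp_series_hasSum_exp' (𝕂 := ℝ) (u • averagingOperator hG)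
  have h1 := ((h.mapL ((lp.evalCLM ℝ (fun _ : V => ℝ) 2 x).comp
    (ContinuousLinearMap.apply ℝ (VertexL2 V) (lp.single 2 o (1 : ℝ))))).mul_left (Real.exp (-u)))
  have e : heatKernel hG o u x = Real.exp (-u) *
      ((lp.evalCLM ℝ (fun _ : V => ℝ) 2 x).comp
        (ContinuousLinearMap.apply ℝ (VertexL2 V) (lp.single 2 o (1 : ℝ))))
        (NormedSpace.exp (u • averagingOperator hG)) := by
    rw [heatKernel, heatSemigroup_eq]
    rfl
  rw [e]
  refine h1.congr_fun fun n => ?_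
  rw [neighborMeanLin_pow_single_symm]
  have e2 : (⇑(lp.single 2 o (1 : ℝ) : VertexL2 V) : V → ℝ) = Pi.single o 1 := by
    ext y; rw [lp.single_apply]
  rw [← e2, ← averagingOperator_pow_apply hG, smul_pow]
  change _ = Real.exp (-u) * ((n.factorial : ℝ)⁻¹ * (u ^ n * _))
  rw [mul_assoc, div_eq_inv_mul, mul_assoc]
  rfl

open Classical in
theorem hasSum_sum_heatKernel (hG : G.IsRegularOfDegree (q + 1)) (o : V) (u : ℝ)
    (R : Finset V) :
    HasSum (fun n : ℕ => Real.exp (-u) * (u ^ n / n.factorial) *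
      (neighborMeanLin G q ^ n) (fun x => if x ∈ R then 1 else 0) o)
      (∑ x ∈ R, heatKernel hG o u x) := by
  have h := hasSum_sum fun x (_ : x ∈ R) => hasSum_heatKernel hG o u x
  refine h.congr_fun fun n => ?_
  rw [← Finset.mul_sum, ← Finset.sum_apply, ← map_sum]
  have e : (∑ x ∈ R, Pi.single x (1 : ℝ) : V → ℝ) = fun x => if x ∈ R then 1 else 0 := by
    ext x
    simp [Finset.sum_apply, Pi.single_apply]
  rw [e]

theorem heatKernel_nonneg (hG : G.IsRegularOfDegree (q + 1)) (o : V) {u : ℝ} (hu : 0 ≤ u)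
    (x : V) : 0 ≤ heatKernel hG o u x := by
  classical
  refine (hasSum_heatKernel hG o u x).nonneg fun n => ?_
  have : (0 : V → ℝ) ≤ Pi.single x 1 := Pi.single_nonneg.mpr zero_le_one
  have := neighborMeanLin_pow_mono (G := G) (q := q) n this o
  rw [map_zero] at this
  have h0 : (0 : ℝ) ≤ (neighborMeanLin G q ^ n) (Pi.single x 1) o := this
  positivity

theorem sum_heatKernel_nonneg (hG : G.IsRegularOfDegree (q + 1)) (o : V) {u : ℝ} (hu : 0 ≤ u)
    (R : Finset V) : 0 ≤ ∑ x ∈ R, heatKernel hG o u x :=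
  Finset.sum_nonneg fun x _ => heatKernel_nonneg hG o hu x

theorem sum_heatKernel_le_one (hG : G.IsRegularOfDegree (q + 1)) (o : V) {u : ℝ} (hu : 0 ≤ u)
    (R : Finset V) : ∑ x ∈ R, heatKernel hG o u x ≤ 1 := by
  classical
  refine hasSum_le (fun n => ?_) (hasSum_sum_heatKernel hG o u R) (hasSum_poisson u)
  refine mul_le_of_le_one_right (by positivity) ?_
  have h : (fun x => if x ∈ R then (1 : ℝ) else 0) ≤ fun _ => 1 := fun x => by
    dsimp only; split_ifs <;> norm_num
  have := neighborMeanLin_pow_mono (G := G) (q := q) n h o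
  rwa [neighborMeanLin_pow_one hG] at this

theorem continuous_heatKernel (hG : G.IsRegularOfDegree (q + 1)) (o x : V) :
    Continuous fun u => heatKernel hG o u x := by
  classical
  have h1 : Continuous fun u : ℝ => heatSemigroup hG u := by
    let _ : NormedAlgebra ℚ (VertexL2 V →L[ℝ] VertexL2 V) := NormedAlgebra.restrictScalars ℚ ℝ _
    exact NormedSpace.exp_continuous.comp (continuous_neg.smul continuous_const)
  exact ((lp.evalCLM ℝ (fun _ : V => ℝ) 2 x).comp
    (ContinuousLinearMap.apply ℝ (VertexL2 V) (lp.single 2 o (1 : ℝ)))).continuous.comp h1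

/-- Chebyshev's inequality for the heat kernel mass of a set whose points have distance from `o`
away from `v u`. -/
theorem sum_heatKernel_le (hq : 2 ≤ q) (hT : G.IsTree) (hG : G.IsRegularOfDegree (q + 1)) (o : V)
    {u B : ℝ} (hu : 0 ≤ u) (hB : 0 ≤ B) (R : Finset V)
    (hR : ∀ x ∈ R, 1 ≤ B * ((G.dist o x : ℝ) - walkSpeed q * u) ^ 2) :
    ∑ x ∈ R, heatKernel hG o u x ≤ B * (4 * u) := by
  classical
  refine hasSum_le (fun n => ?_) (hasSum_sum_heatKernel hG o u R)
    ((hasSum_poisson_second_moment u).mul_left B)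
  have h : (fun x => if x ∈ R then (1 : ℝ) else 0)
      ≤ B • fun x => ((G.dist o x : ℝ) - walkSpeed q * u) ^ 2 := fun x => by
    by_cases hx : x ∈ R
    · simpa [hx] using hR x hx
    · simp only [hx, if_false, Pi.smul_apply, smul_eq_mul]
      positivity
  have h1 := neighborMeanLin_pow_mono (G := G) (q := q) n h o
  rw [map_smul] at h1
  have h2 := h1.trans (mul_le_mul_of_nonneg_left
    (neighborMeanLin_pow_sq_dist_sub_le hq hT hG o n u) hB)
  calc _ ≤ Real.exp (-u) * (u ^ n / n.factorial) * (B * (2 * n + 2 * (n - u) ^ 2)) := by gcongr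
    _ = _ := by ring

/-- Chebyshev's inequality for the heat kernel mass of a set containing every point whose distance
from `o` is close to `v u`. -/
theorem le_sum_heatKernel (hq : 2 ≤ q) (hT : G.IsTree) (hG : G.IsRegularOfDegree (q + 1)) (o : V)
    {u B : ℝ} (hu : 0 ≤ u) (hB : 0 ≤ B) (R : Finset V)
    (hR : ∀ x ∉ R, 1 ≤ B * ((G.dist o x : ℝ) - walkSpeed q * u) ^ 2) :
    1 - B * (4 * u) ≤ ∑ x ∈ R, heatKernel hG o u x := by
  classical
  refine hasSum_le (fun n => ?_)
    ((hasSum_poisson u).sub ((hasSum_poisson_second_moment u).mul_left B))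
    (hasSum_sum_heatKernel hG o u R)
  have h : (fun _ => 1) ≤ (fun x => if x ∈ R then (1 : ℝ) else 0)
      + B • fun x => ((G.dist o x : ℝ) - walkSpeed q * u) ^ 2 := fun x => by
    by_cases hx : x ∈ R
    · simp only [Pi.add_apply, hx, if_true, Pi.smul_apply, smul_eq_mul, le_add_iff_nonneg_right]
      positivity
    · simpa [hx] using hR x hx
  have h1 := neighborMeanLin_pow_mono (G := G) (q := q) n h o
  rw [map_add, map_smul, neighborMeanLin_pow_one hG] at h1
  have h2 := mul_le_mul_of_nonneg_left (neighborMeanLin_pow_sq_dist_sub_le hq hT hG o n u) hB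
  simp only [Pi.add_apply, Pi.smul_apply, smul_eq_mul] at h1
  have h3 : 1 - B * (2 * n + 2 * (n - u) ^ 2)
      ≤ (neighborMeanLin G q ^ n) (fun x => if x ∈ R then (1 : ℝ) else 0) o := by linarith
  calc _ = Real.exp (-u) * (u ^ n / n.factorial) * (1 - B * (2 * n + 2 * (n - u) ^ 2)) := by ring
    _ ≤ _ := by gcongr

end HeatKernel

/-! ### Moments of Laplace transforms and positivity -/

section Laplace

theorem integrableOn_laplace_mul_and_hasDerivAt {g : ℝ → ℝ}
    (hg : ∀ l : ℝ, 0 < l → IntegrableOn (fun u => Real.exp (-(l * u)) * g u) (Ioi 0))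
    {l : ℝ} (hl : 0 < l) :
    IntegrableOn (fun u => Real.exp (-(l * u)) * (u * g u)) (Ioi 0) ∧
      HasDerivAt (fun l => ∫ u in Ioi (0 : ℝ), Real.exp (-(l * u)) * g u)
        (-∫ u in Ioi (0 : ℝ), Real.exp (-(l * u)) * (u * g u)) l := by
  have key := hasDerivAt_integral_of_dominated_loc_of_deriv_le (𝕜 := ℝ)
    (μ := volume.restrict (Ioi (0 : ℝ)))
    (F := fun l u => Real.exp (-(l * u)) * g u)
    (F' := fun l u => -(u * (Real.exp (-(l * u)) * g u)))
    -- For `l' > l / 2`, half of `exp (-(l / 2) u)` absorbs the factor `u`, since `u ≤ (4 / l) exp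
    -- (l u / 4)`; the other half keeps `g` integrable.
    (bound := fun u => 4 / l * ‖Real.exp (-(l / 4 * u)) * g u‖) (x₀ := l) (s := Ioi (l / 2))
    (Ioi_mem_nhds (by linarith))
    (by
      filter_upwards [Ioi_mem_nhds hl] with l' hl'
      exact (hg l' hl').aestronglyMeasurable)
    (hg l hl)
    ((continuous_id.aestronglyMeasurable.mul (hg l hl).aestronglyMeasurable).neg)
    (by
      refine (ae_restrict_iff' measurableSet_Ioi).mpr (Eventually.of_forall fun u hu l' hl' => ?_)
      have hu : 0 < u := hu
      have hl' : l / 2 < l' := hl'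
      rw [norm_neg, norm_mul, norm_mul, norm_mul, Real.norm_eq_abs u, abs_of_pos hu,
        Real.norm_eq_abs (Real.exp _), Real.norm_eq_abs (Real.exp _), Real.abs_exp, Real.abs_exp,
        ← mul_assoc, ← mul_assoc]
      refine mul_le_mul_of_nonneg_right ?_ (norm_nonneg _)
      have h1 : l / 4 * u ≤ Real.exp (l / 4 * u) := by
        linarith [Real.add_one_le_exp (l / 4 * u)]
      have h2 : Real.exp (-(l' * u)) ≤ Real.exp (-(l / 4 * u)) * Real.exp (-(l / 4 * u)) := by
        rw [← Real.exp_add]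
        apply Real.exp_le_exp.mpr
        nlinarith
      have h3 : Real.exp (l / 4 * u) * Real.exp (-(l / 4 * u)) = 1 := by
        rw [← Real.exp_add]; simp
      have h4 : u ≤ 4 / l * Real.exp (l / 4 * u) := by
        calc u = 4 / l * (l / 4 * u) := by field_simp
          _ ≤ _ := by gcongr
      calc u * Real.exp (-(l' * u))
          ≤ (4 / l * Real.exp (l / 4 * u)) *
            (Real.exp (-(l / 4 * u)) * Real.exp (-(l / 4 * u))) := by gcongr
        _ = 4 / l * Real.exp (-(l / 4 * u)) *
            (Real.exp (l / 4 * u) * Real.exp (-(l / 4 * u))) := by ring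
        _ = _ := by rw [h3, mul_one])
    (((hg (l / 4) (by linarith)).norm).const_mul _)
    (by
      refine Eventually.of_forall fun u l' _ => ?_
      have h1 : HasDerivAt (fun l' : ℝ => -(l' * u)) (-u) l' := by
        simpa using ((hasDerivAt_id' l').mul_const u).fun_neg
      have := h1.exp.mul_const (g u)
      exact this.congr_deriv (by ring))
  obtain ⟨k1, k2⟩ := key
  have e : (fun u => -(u * (Real.exp (-(l * u)) * g u)))
      = fun u => -(Real.exp (-(l * u)) * (u * g u)) := by ext u; ring
  rw [e] at k1 k2
  rw [integral_neg] at k2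
  refine ⟨?_, k2⟩
  have := k1.neg
  simp only [Pi.neg_def, neg_neg] at this
  exact this

/-- The cone spanned by the functions `l ↦ l ^ (-a) * exp (-l ^ b)`, `0 ≤ a`. -/
inductive StableCone (b : ℝ) : (ℝ → ℝ) → Prop
  | term (c a : ℝ) (hc : 0 ≤ c) (ha : 0 ≤ a) :
      StableCone b (fun l => c * l ^ (-a) * Real.exp (-l ^ b))
  | add (f g : ℝ → ℝ) (hf : StableCone b f) (hg : StableCone b g) :
      StableCone b (fun l => f l + g l)

theorem StableCone.nonneg {b : ℝ} {f : ℝ → ℝ} (hf : StableCone b f) {l : ℝ} (hl : 0 < l) :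
    0 ≤ f l := by
  induction hf with
  | term c a hc ha => positivity
  | add f g _ _ h1 h2 => exact add_nonneg h1 h2

/-- Differentiating the power turns the exponent `a` into `a + 1`, differentiating the exponential
turns it into `a + 1 - b`, which is nonnegative as `b < 1`. Iterated, this is the complete
monotonicity of `exp (-l ^ b)`. -/
theorem StableCone.exists_hasDerivAt {b : ℝ} (hb0 : 0 < b) (hb1 : b < 1) {f : ℝ → ℝ}
    (hf : StableCone b f) :
    ∃ g, StableCone b g ∧ ∀ l : ℝ, 0 < l → HasDerivAt f (-(g l)) l := by
  induction hf with
  | term c a hc ha =>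
    refine ⟨_, .add _ _ (.term (c * a) (a + 1) (by positivity) (by positivity))
      (.term (c * b) (a + 1 - b) (by positivity) (by linarith)), fun l hl => ?_⟩
    have h1 := ((Real.hasDerivAt_rpow_const (p := -a) (Or.inl hl.ne')).const_mul c).mul
      ((Real.hasDerivAt_rpow_const (p := b) (Or.inl hl.ne')).fun_neg.exp)
    refine h1.congr_deriv ?_
    have e1 : -a - 1 = -(a + 1) := by ring
    have e2 : l ^ (-(a + 1 - b)) = l ^ (-a) * l ^ (b - 1) := by
      rw [← Real.rpow_add hl]; congr 1; ring
    rw [e1, e2]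
    ring
  | add f g _ _ h1 h2 =>
    obtain ⟨f', hf', hf1⟩ := h1
    obtain ⟨g', hg', hg1⟩ := h2
    refine ⟨_, .add _ _ hf' hg', fun l hl => ?_⟩
    exact ((hf1 l hl).add (hg1 l hl)).congr_deriv (by ring)

/-- The integral is `(-1) ^ k` times the `k`-th derivative of the transform, which stays in the
cone. The induction passes to `u * g u`, so `f` and `g` must vary. -/
theorem StableCone.laplace_moment_nonneg {b : ℝ} (hb0 : 0 < b) (hb1 : b < 1) (k : ℕ) :
    ∀ {f g : ℝ → ℝ}, StableCone b f →
      (∀ l : ℝ, 0 < l → IntegrableOn (fun u => Real.exp (-(l * u)) * g u) (Ioi 0)) →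
      (∀ l : ℝ, 0 < l → ∫ u in Ioi (0 : ℝ), Real.exp (-(l * u)) * g u = f l) →
      ∀ l : ℝ, 0 < l → 0 ≤ ∫ u in Ioi (0 : ℝ), Real.exp (-(l * u)) * (u ^ k * g u) := by
  induction k with
  | zero =>
    intro f g hf _ h l hl
    simp only [pow_zero, one_mul]
    rw [h l hl]
    exact hf.nonneg hl
  | succ k ih =>
    intro f g hf hg h l hl
    obtain ⟨f', hf', hd⟩ := hf.exists_hasDerivAt hb0 hb1
    have := ih (g := fun u => u * g u) hf'
      (fun l hl => (integrableOn_laplace_mul_and_hasDerivAt hg hl).1)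
      (fun l hl => by
        have h1 := (integrableOn_laplace_mul_and_hasDerivAt hg hl).2
        have h2 := (hd l hl).congr_of_eventuallyEq
          (f₁ := fun l => ∫ u in Ioi (0 : ℝ), Real.exp (-(l * u)) * g u)
          (by filter_upwards [Ioi_mem_nhds hl] with l' hl' using h l' hl')
        exact neg_injective (h1.unique h2)) l hl
    simpa only [pow_succ, mul_assoc] using this

theorem integral_exp_neg_mul_pow (k : ℕ) {l : ℝ} (hl : 0 < l) :
    ∫ u in Ioi (0 : ℝ), Real.exp (-(l * u)) * u ^ k = k.factorial / l ^ (k + 1) := by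
  have h := Real.integral_rpow_mul_exp_neg_mul_Ioi (a := k + 1) (r := l) (by positivity) hl
  rw [Real.Gamma_nat_eq_factorial] at h
  rw [show (k.factorial : ℝ) / l ^ (k + 1) = (1 / l) ^ ((k : ℝ) + 1) * k.factorial by
    rw [one_div, Real.inv_rpow hl.le]
    norm_cast
    rw [div_eq_inv_mul], ← h]
  refine setIntegral_congr_fun measurableSet_Ioi fun u hu => ?_
  simp only [add_sub_cancel_right, Real.rpow_natCast]
  ring

theorem integrableOn_exp_neg_mul_pow (k : ℕ) {l : ℝ} (hl : 0 < l) :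
    IntegrableOn (fun u => Real.exp (-(l * u)) * u ^ k) (Ioi 0) := by
  -- The integral of a nonintegrable function is `0` by convention, so a nonzero value proves
  -- integrability.
  refine not_imp_comm.mp integral_undef ?_
  rw [integral_exp_neg_mul_pow k hl]
  positivity

/-- A bounded function all of whose exponentially weighted moments are nonnegative is nonnegative
at its points of continuity. -/
theorem nonneg_of_laplace_moment_nonneg {g : ℝ → ℝ} {C : ℝ} (hC : ∀ u, 0 < u → g u ≤ C)
    (hgi : ∀ (k : ℕ) (l : ℝ), 0 < l →
      IntegrableOn (fun u => Real.exp (-(l * u)) * (u ^ k * g u)) (Ioi 0))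
    (hg : ∀ (k : ℕ) (l : ℝ), 0 < l →
      0 ≤ ∫ u in Ioi (0 : ℝ), Real.exp (-(l * u)) * (u ^ k * g u))
    {x : ℝ} (hx : 0 < x) (hcont : ContinuousAt g x) : 0 ≤ g x := by
  by_contra! hneg
  set ε := -(g x) / 2 with hε
  have hε0 : 0 < ε := by linarith
  obtain ⟨δ, hδ, hball⟩ := Metric.continuousAt_iff.mp hcont ε hε0
  set D := |C| + ε with hD
  have hD0 : 0 < D := by positivity
  -- A quadratic majorant: near `x` continuity gives `g u < g x + ε = -ε`; elsewhere the square
  -- contributes at least `D`, and `-ε + D = |C|`.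
  have hbound : ∀ u, 0 < u → g u ≤ -ε + D / δ ^ 2 * (u - x) ^ 2 := by
    intro u hu
    by_cases h : |u - x| < δ
    · have := hball (show dist u x < δ from h)
      rw [Real.dist_eq] at this
      have h1 := (abs_lt.mp this).2
      have : 0 ≤ D / δ ^ 2 * (u - x) ^ 2 := by positivity
      linarith
    · have h1 : 1 ≤ (u - x) ^ 2 / δ ^ 2 := by
        rw [one_le_div (by positivity), ← sq_abs (u - x)]
        exact pow_le_pow_left₀ hδ.le (not_lt.mp h) 2
      have h2 : D ≤ D / δ ^ 2 * (u - x) ^ 2 := by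
        calc D = D * 1 := (mul_one _).symm
          _ ≤ D * ((u - x) ^ 2 / δ ^ 2) := by gcongr
          _ = _ := by ring
      have := hC u hu
      have := le_abs_self C
      linarith
  -- Test against the Gamma weight `u ^ k exp (-l u)` with `l = k / x`, whose peak is at `x`. Under
  -- its normalisation `(u - x) ^ 2` has mean `x ^ 2 (k + 2) / k ^ 2`.
  have hstep : ∀ k : ℕ, 0 < k → ε * k ^ 2 ≤ D / δ ^ 2 * x ^ 2 * (k + 2) := by
    intro k hk
    have hk' : (0 : ℝ) < k := by exact_mod_cast hk
    set l := (k : ℝ) / x with hl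
    have hl0 : 0 < l := by positivity
    set E := D / δ ^ 2 with hE
    have i0 := integrableOn_exp_neg_mul_pow k hl0
    have i1 := integrableOn_exp_neg_mul_pow (k + 1) hl0
    have i2 := integrableOn_exp_neg_mul_pow (k + 2) hl0
    have j := ((i0.const_mul (-ε + E * x ^ 2)).add (i1.const_mul (-2 * E * x))).add
      (i2.const_mul E)
    have h1 : ∫ u in Ioi (0 : ℝ), Real.exp (-(l * u)) * (u ^ k * g u)
        ≤ ∫ u in Ioi (0 : ℝ), ((-ε + E * x ^ 2) * (Real.exp (-(l * u)) * u ^ k)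
          + (-2 * E * x) * (Real.exp (-(l * u)) * u ^ (k + 1))
          + E * (Real.exp (-(l * u)) * u ^ (k + 2))) := by
      refine setIntegral_mono_on (hgi k l hl0) j measurableSet_Ioi fun u hu => ?_
      have hu : 0 < u := hu
      calc Real.exp (-(l * u)) * (u ^ k * g u)
          ≤ Real.exp (-(l * u)) * (u ^ k * (-ε + E * (u - x) ^ 2)) := by
            gcongr; exact hbound u hu
        _ = _ := by ring
    have h2 := (hg k l hl0).trans h1
    rw [integral_add (f := fun u => (-ε + E * x ^ 2) * (Real.exp (-(l * u)) * u ^ k)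
        + (-2 * E * x) * (Real.exp (-(l * u)) * u ^ (k + 1))) ((i0.const_mul _).add (i1.const_mul _)) (i2.const_mul _),
      integral_add (i0.const_mul _) (i1.const_mul _), integral_const_mul, integral_const_mul,
      integral_const_mul, integral_exp_neg_mul_pow _ hl0, integral_exp_neg_mul_pow _ hl0,
      integral_exp_neg_mul_pow _ hl0, Nat.factorial_succ (k + 1), Nat.factorial_succ k] at h2
    have h3 : (-ε + E * x ^ 2) * (k.factorial / l ^ (k + 1))
        + (-2 * E * x) * (((k + 1) * k.factorial : ℕ) / l ^ (k + 1 + 1))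
        + E * (((k + 1 + 1) * ((k + 1) * k.factorial) : ℕ) / l ^ (k + 2 + 1))
        = (k.factorial / (l ^ (k + 1) * k ^ 2)) * (-ε * k ^ 2 + E * x ^ 2 * (k + 2)) := by
      have hxl : x = k / l := by rw [hl]; field_simp
      clear_value l E
      rw [hxl]
      push_cast
      field_simp
      ring
    rw [h3] at h2
    have h4 : 0 < (k.factorial : ℝ) / (l ^ (k + 1) * k ^ 2) := by positivity
    have h5 := nonneg_of_mul_nonneg_right h2 h4
    linarith
  set M := D / δ ^ 2 * x ^ 2 with hM
  have hM0 : 0 < M := by positivity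
  -- For `n ≥ 1`, `n + 2 ≤ 3 n`, so `hstep` would force `ε n ≤ 3 M`.
  obtain ⟨n, hn⟩ := exists_nat_gt (3 * M / ε)
  have hn0 : (0 : ℝ) < n := lt_trans (by positivity) hn
  have hn1 : (1 : ℝ) ≤ n := by
    have : 0 < n := by exact_mod_cast hn0
    exact_mod_cast this
  have := hstep n (by exact_mod_cast hn0)
  rw [div_lt_iff₀ hε0] at hn
  nlinarith

end Laplace

/-! ### Cauchy's formula for `exp (-z ^ b)` on the right half plane -/

section StableExponent

/-- The function `z ↦ exp (-z ^ b)`. -/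
noncomputable def stableExp (b : ℝ) (z : ℂ) : ℂ := Complex.exp (-z ^ (b : ℂ))

theorem stableExp_ofReal (b : ℝ) {l : ℝ} (hl : 0 ≤ l) :
    stableExp b l = (Real.exp (-l ^ b) : ℝ) := by
  rw [stableExp, ← Complex.ofReal_cpow hl]
  push_cast
  rfl

theorem continuousAt_stableExp {b : ℝ} (hb : 0 < b) {z : ℂ} (hz : 0 ≤ z.re) :
    ContinuousAt (stableExp b) z :=
  (Complex.continuousAt_cpow_const_of_re_pos (Or.inl hz) (by simpa using hb)).neg.cexp

theorem differentiableAt_stableExp (b : ℝ) {z : ℂ} (hz : 0 < z.re) :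
    DifferentiableAt ℂ (stableExp b) z :=
  ((differentiableAt_id.cpow_const (Or.inl hz)).neg).cexp

theorem cos_mul_pi_div_two_pos {b : ℝ} (hb0 : 0 < b) (hb1 : b < 1) :
    0 < Real.cos (b * (Real.pi / 2)) := by
  have := Real.pi_pos
  apply Real.cos_pos_of_mem_Ioo
  constructor <;> nlinarith

/-- The real part of `z ^ b` is `‖z‖ ^ b cos (b arg z)`, and `|arg z| ≤ π / 2` on the half plane.
The constant is positive because `b < 1`. -/
theorem norm_stableExp_le {b : ℝ} (hb0 : 0 < b) (hb1 : b < 1) {z : ℂ} (hz : 0 ≤ z.re) :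
    ‖stableExp b z‖ ≤ Real.exp (-(Real.cos (b * (Real.pi / 2)) * ‖z‖ ^ b)) := by
  rw [stableExp, Complex.norm_exp, Complex.neg_re, Complex.cpow_ofReal_re, mul_comm (_ ^ b)]
  have h1 := Complex.abs_arg_le_pi_div_two_iff.mpr hz
  have h2 : Real.cos (b * (Real.pi / 2)) ≤ Real.cos (z.arg * b) := by
    rw [← Real.cos_abs (z.arg * b), abs_mul, abs_of_pos hb0, mul_comm |z.arg|]
    apply Real.cos_le_cos_of_nonneg_of_le_pi (by positivity)
    · nlinarith [Real.pi_pos]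
    · gcongr
  gcongr

theorem norm_stableExp_le_one {b : ℝ} (hb0 : 0 < b) (hb1 : b < 1) {z : ℂ} (hz : 0 ≤ z.re) :
    ‖stableExp b z‖ ≤ 1 := by
  refine (norm_stableExp_le hb0 hb1 hz).trans (Real.exp_le_one_iff.mpr ?_)
  have := cos_mul_pi_div_two_pos hb0 hb1
  have : 0 ≤ Real.cos (b * (Real.pi / 2)) * ‖z‖ ^ b := by positivity
  linarith

theorem integrable_exp_neg_mul_abs_rpow {b c : ℝ} (hb : 0 < b) (hc : 0 < c) :
    Integrable fun x : ℝ => Real.exp (-(c * |x| ^ b)) := by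
  refine not_imp_comm.mp integral_undef ?_
  rw [integral_comp_abs (f := fun x => Real.exp (-(c * x ^ b)))]
  simp_rw [← neg_mul]
  rw [integral_exp_neg_mul_rpow hb hc]
  have := Real.Gamma_pos_of_pos (s := 1 / b + 1) (by positivity)
  positivity

theorem continuous_stableExp_I {b : ℝ} (hb : 0 < b) :
    Continuous fun y : ℝ => stableExp b (y * Complex.I) := by
  refine continuous_iff_continuousAt.mpr fun y => ?_
  refine ContinuousAt.comp (f := fun y : ℝ => (y : ℂ) * Complex.I) (g := stableExp b) ?_ ?_
  · exact continuousAt_stableExp hb (by simp)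
  · fun_prop

theorem integrable_stableExp_I {b : ℝ} (hb0 : 0 < b) (hb1 : b < 1) :
    Integrable fun y : ℝ => stableExp b (y * Complex.I) := by
  refine (integrable_exp_neg_mul_abs_rpow hb0 (cos_mul_pi_div_two_pos hb0 hb1)).mono'
    (continuous_stableExp_I hb0).aestronglyMeasurable (Eventually.of_forall fun y => ?_)
  simpa using norm_stableExp_le hb0 hb1 (z := y * Complex.I) (by simp)

theorem integral_univ_inv_sq_add_sq {l : ℝ} (hl : 0 < l) :
    ∫ y : ℝ, (l ^ 2 + y ^ 2)⁻¹ = Real.pi / l := by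
  have h : ∀ y : ℝ, (l ^ 2 + y ^ 2)⁻¹ = (l ^ 2)⁻¹ * (1 + (y / l) ^ 2)⁻¹ := by
    intro y
    rw [← mul_inv]
    congr 1
    field_simp
  simp_rw [h]
  rw [integral_const_mul, Measure.integral_comp_div (fun y => (1 + y ^ 2)⁻¹) l,
    integral_univ_inv_one_add_sq, abs_of_pos hl, smul_eq_mul]
  field_simp

theorem integrable_inv_sq_add_sq {l : ℝ} (hl : 0 < l) :
    Integrable fun y : ℝ => (l ^ 2 + y ^ 2)⁻¹ := by
  refine not_imp_comm.mp integral_undef ?_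
  rw [integral_univ_inv_sq_add_sq hl]
  have := Real.pi_pos
  positivity

/-- `exp (-z ^ b)` corrected by a rational function so as to vanish at `l`. -/
noncomputable def stableNumerator (b l : ℝ) (z : ℂ) : ℂ :=
  stableExp b z - stableExp b l * (2 * l / (l + z))

theorem stableNumerator_self {b l : ℝ} (hl : 0 < l) : stableNumerator b l l = 0 := by
  have : (l : ℂ) ≠ 0 := by exact_mod_cast hl.ne'
  rw [stableNumerator]
  field_simp
  ring

theorem ofReal_add_ne_zero {l : ℝ} (hl : 0 < l) {z : ℂ} (hz : 0 ≤ z.re) : (l : ℂ) + z ≠ 0 := by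
  intro h
  have := congrArg Complex.re h
  simp at this
  linarith

theorem ofReal_mul_I_sub_ne_zero {l : ℝ} (hl : 0 < l) (y : ℝ) :
    (y : ℂ) * Complex.I - l ≠ 0 := by
  intro h
  have := congrArg Complex.re h
  simp at this
  linarith

theorem dslope_stableNumerator {b l : ℝ} (hl : 0 < l) {z : ℂ} (hz : z ≠ l) :
    dslope (stableNumerator b l) l z = stableNumerator b l z / (z - l) := by
  rw [dslope_of_ne _ hz, slope_def_field, stableNumerator_self hl, sub_zero]

theorem norm_dslope_stableNumerator_le {b l R : ℝ} (hb0 : 0 < b) (hb1 : b < 1) (hl : 0 < l)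
    (hR : 2 * l ≤ R) {z : ℂ} (hz : 0 ≤ z.re) (hzR : R ≤ ‖z‖) :
    ‖dslope (stableNumerator b l) l z‖
      ≤ (Real.exp (-(Real.cos (b * (Real.pi / 2)) * R ^ b)) + 4 * l / R) * (2 / R) := by
  have hR0 : 0 < R := by linarith
  have hc := cos_mul_pi_div_two_pos hb0 hb1
  have hl' : ‖(l : ℂ)‖ = l := by rw [Complex.norm_real, Real.norm_of_nonneg hl.le]
  have hne : z ≠ l := by
    rintro rfl
    rw [hl'] at hzR
    linarith
  have h1 : R / 2 ≤ ‖z - l‖ := by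
    have := norm_sub_norm_le z (l : ℂ)
    linarith
  have h2 : R / 2 ≤ ‖(l : ℂ) + z‖ := by
    have := norm_sub_norm_le z (-(l : ℂ))
    rw [norm_neg, sub_neg_eq_add, add_comm z] at this
    linarith
  have h3 : ‖stableNumerator b l z‖
      ≤ Real.exp (-(Real.cos (b * (Real.pi / 2)) * R ^ b)) + 4 * l / R := by
    refine norm_sub_le_of_le ?_ ?_
    · refine (norm_stableExp_le hb0 hb1 hz).trans ?_
      gcongr
    · have h4 := norm_stableExp_le_one hb0 hb1 (z := (l : ℂ)) (by simpa using hl.le)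
      rw [norm_mul, norm_div, norm_mul, hl', Complex.norm_ofNat]
      calc ‖stableExp b l‖ * (2 * l / ‖(l : ℂ) + z‖) ≤ 1 * (2 * l / (R / 2)) := by gcongr
        _ = _ := by field_simp; ring
  rw [dslope_stableNumerator hl hne, norm_div, div_eq_mul_inv]
  have h5 : ‖z - l‖⁻¹ ≤ 2 / R := by
    rw [show 2 / R = (R / 2)⁻¹ by rw [inv_div]]
    exact inv_anti₀ (by positivity) h1
  gcongr

/-- The numerator vanishes at `l`, so the quotient extends continuously there and Cauchy–Goursat
applies on `[0, R] × [-R, R]` with `l` as an exceptional point: no residue is needed. The other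
three sides have total length `4 R`, which against the pointwise bound with factor `2 / R` gives
`8`. -/
theorem norm_integral_dslope_stableNumerator_le {b l R : ℝ} (hb0 : 0 < b) (hb1 : b < 1)
    (hl : 0 < l) (hR : 2 * l ≤ R) :
    ‖∫ y in (-R)..R, dslope (stableNumerator b l) l (y * Complex.I)‖
      ≤ 8 * (Real.exp (-(Real.cos (b * (Real.pi / 2)) * R ^ b)) + 4 * l / R) := by
  have hR0 : 0 < R := by linarith
  set D := dslope (stableNumerator b l) l with hD
  set M := (Real.exp (-(Real.cos (b * (Real.pi / 2)) * R ^ b)) + 4 * l / R) * (2 / R) with hM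
  have hnhds : {z : ℂ | 0 ≤ z.re} ∈ 𝓝 (l : ℂ) := by
    have : {z : ℂ | 0 < z.re} ∈ 𝓝 (l : ℂ) :=
      (isOpen_lt continuous_const Complex.continuous_re).mem_nhds (by simpa using hl)
    exact mem_of_superset this fun z (hz : 0 < z.re) => hz.le
  have hdiff : ∀ z : ℂ, 0 < z.re → DifferentiableAt ℂ (stableNumerator b l) z := fun z hz =>
    (differentiableAt_stableExp b hz).sub (((differentiableAt_const _).div
      ((differentiableAt_const _).add differentiableAt_id)
      (ofReal_add_ne_zero hl hz.le)).const_mul _)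
  have hcontN : ContinuousOn (stableNumerator b l) {z : ℂ | 0 ≤ z.re} := fun z hz =>
    ((continuousAt_stableExp hb0 hz).sub ((continuousAt_const.div
      (continuousAt_const.add continuousAt_id)
      (ofReal_add_ne_zero hl hz)).const_mul _)).continuousWithinAt
  have hcont : ContinuousOn D {z : ℂ | 0 ≤ z.re} :=
    (continuousOn_dslope hnhds).mpr ⟨hcontN, hdiff _ (by simpa using hl)⟩
  have hrect := Complex.integral_boundary_rect_eq_zero_of_differentiable_on_off_countable D
    ⟨0, -R⟩ ⟨R, R⟩ {(l : ℂ)} (countable_singleton _)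
    (hcont.mono fun z hz => by
      have h1 := hz.1
      rw [mem_preimage, uIcc_of_le hR0.le] at h1
      exact h1.1)
    (fun z hz => by
      have h1 := hz.1.1
      rw [mem_preimage, min_eq_left hR0.le] at h1
      exact (differentiableAt_dslope_of_ne hz.2).mpr (hdiff z h1.1))
  simp only [Complex.ofReal_zero, zero_add] at hrect
  have e : Complex.I • ∫ y in (-R)..R, D (y * Complex.I)
      = ((∫ x in (0 : ℝ)..R, D (x + (-R : ℝ) * Complex.I))
        - ∫ x in (0 : ℝ)..R, D (x + (R : ℝ) * Complex.I))
        + Complex.I • ∫ y in (-R)..R, D ((R : ℝ) + y * Complex.I) :=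
    (sub_eq_zero.mp hrect).symm
  have n1 : ‖∫ x in (0 : ℝ)..R, D (x + (-R : ℝ) * Complex.I)‖ ≤ M * |R - 0| := by
    refine intervalIntegral.norm_integral_le_of_norm_le_const fun x hx => ?_
    rw [uIoc_of_le hR0.le] at hx
    refine norm_dslope_stableNumerator_le hb0 hb1 hl hR (by simpa using hx.1.le) ?_
    refine le_trans ?_ (Complex.abs_im_le_norm _)
    simp [abs_of_pos hR0]
  have n2 : ‖∫ x in (0 : ℝ)..R, D (x + (R : ℝ) * Complex.I)‖ ≤ M * |R - 0| := by
    refine intervalIntegral.norm_integral_le_of_norm_le_const fun x hx => ?_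
    rw [uIoc_of_le hR0.le] at hx
    refine norm_dslope_stableNumerator_le hb0 hb1 hl hR (by simpa using hx.1.le) ?_
    refine le_trans ?_ (Complex.abs_im_le_norm _)
    simp [abs_of_pos hR0]
  have n3 : ‖∫ y in (-R)..R, D ((R : ℝ) + y * Complex.I)‖ ≤ M * |R - -R| := by
    refine intervalIntegral.norm_integral_le_of_norm_le_const fun x hx => ?_
    refine norm_dslope_stableNumerator_le hb0 hb1 hl hR (by simpa using hR0.le) ?_
    refine le_trans ?_ (Complex.abs_re_le_norm _)
    simp [abs_of_pos hR0]
  have n4 : ‖Complex.I • ∫ y in (-R)..R, D (y * Complex.I)‖ ≤ M * R + M * R + M * (2 * R) := by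
    rw [e]
    refine norm_add_le_of_le (norm_sub_le_of_le ?_ ?_) ?_
    · simpa [abs_of_pos hR0] using n1
    · simpa [abs_of_pos hR0] using n2
    · rw [norm_smul, Complex.norm_I, one_mul]
      rwa [show |R - -R| = 2 * R by rw [abs_of_pos] <;> linarith] at n3
  rw [norm_smul, Complex.norm_I, one_mul] at n4
  refine n4.trans (le_of_eq ?_)
  rw [hM]
  field_simp
  ring

/-- Cauchy's integral formula on the right half plane for `exp (-z ^ b)`. -/
theorem integral_stableExp_div {b l : ℝ} (hb0 : 0 < b) (hb1 : b < 1) (hl : 0 < l) :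
    ∫ y : ℝ, stableExp b (y * Complex.I) / (l - y * Complex.I)
      = 2 * Real.pi * Real.exp (-l ^ b) := by
  have hlC : (l : ℂ) ≠ 0 := by exact_mod_cast hl.ne'
  have i1 : Integrable fun y : ℝ => stableExp b (y * Complex.I) / (l - y * Complex.I) := by
    simp_rw [div_eq_inv_mul]
    refine (integrable_stableExp_I hb0 hb1).bdd_mul (c := l⁻¹) ?_ (Eventually.of_forall fun y => ?_)
    · refine (Continuous.inv₀ (by fun_prop) fun y => ?_).aestronglyMeasurable
      rw [← neg_ne_zero, neg_sub]
      exact ofReal_mul_I_sub_ne_zero hl y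
    · rw [norm_inv]
      refine inv_anti₀ hl ?_
      refine le_trans ?_ (Complex.abs_re_le_norm _)
      simp [abs_of_pos hl]
  have i2 : Integrable fun y : ℝ => (((l ^ 2 + y ^ 2)⁻¹ : ℝ) : ℂ) :=
    (integrable_inv_sq_add_sq hl).ofReal
  -- On the imaginary axis the correction term becomes a multiple of `2 l / (l ^ 2 + y ^ 2)`, whose
  -- integral is `2 π`; this supplies the right-hand side of the formula.
  have e : ∀ y : ℝ, dslope (stableNumerator b l) l (y * Complex.I)
      = -(stableExp b (y * Complex.I) / (l - y * Complex.I))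
        + (stableExp b l * (2 * l)) * (((l ^ 2 + y ^ 2)⁻¹ : ℝ) : ℂ) := by
    intro y
    have h1 := ofReal_mul_I_sub_ne_zero hl y
    have h2 : (l : ℂ) - y * Complex.I ≠ 0 := by rw [← neg_ne_zero, neg_sub]; exact h1
    have h3 := ofReal_add_ne_zero hl (z := y * Complex.I) (by simp)
    rw [dslope_stableNumerator hl (sub_ne_zero.mp h1), stableNumerator, sub_div]
    have h4 : (((l ^ 2 + y ^ 2)⁻¹ : ℝ) : ℂ)
        = (((l : ℂ) + y * Complex.I) * (l - y * Complex.I))⁻¹ := by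
      push_cast
      congr 1
      linear_combination (y : ℂ) ^ 2 * Complex.I_sq
    have h5 : (y : ℂ) * Complex.I - l = -(l - y * Complex.I) := by ring
    rw [h4, h5]
    field_simp
    ring
  have hint : Integrable fun y : ℝ => dslope (stableNumerator b l) l (y * Complex.I) := by
    simp_rw [e]
    exact i1.neg.add (i2.const_mul _)
  have t1 := intervalIntegral_tendsto_integral hint tendsto_neg_atTop_atBot tendsto_id
  have t2 : Tendsto (fun R => ∫ y in (-R)..R, dslope (stableNumerator b l) l (y * Complex.I))
      atTop (𝓝 0) := by
    refine squeeze_zero_norm' (a := fun R =>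
      8 * (Real.exp (-(Real.cos (b * (Real.pi / 2)) * R ^ b)) + 4 * l / R)) ?_ ?_
    · filter_upwards [eventually_ge_atTop (2 * l)] with R hR
      exact norm_integral_dslope_stableNumerator_le hb0 hb1 hl hR
    · have a1 : Tendsto (fun R : ℝ => Real.exp (-(Real.cos (b * (Real.pi / 2)) * R ^ b)))
          atTop (𝓝 0) := Real.tendsto_exp_neg_atTop_nhds_zero.comp
        ((tendsto_rpow_atTop hb0).const_mul_atTop (cos_mul_pi_div_two_pos hb0 hb1))
      have a2 : Tendsto (fun R : ℝ => 4 * l / R) atTop (𝓝 0) :=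
        tendsto_const_nhds.div_atTop tendsto_id
      simpa using (a1.add a2).const_mul 8
  have h0 := tendsto_nhds_unique t1 t2
  simp_rw [e] at h0
  rw [integral_add i1.fun_neg (i2.const_mul _), integral_neg, integral_const_mul,
    integral_complex_ofReal, integral_univ_inv_sq_add_sq hl, stableExp_ofReal b hl.le,
    neg_add_eq_zero] at h0
  rw [h0]
  push_cast
  field_simp

end StableExponent

/-! ### Construction of the stable density -/

section StableDensity

/-- Inverse Fourier transform of `y ↦ exp (-(i y) ^ b)`. -/
noncomputable def stableInv (b u : ℝ) : ℂ :=
  (2 * Real.pi : ℝ)⁻¹ * ∫ y : ℝ, Complex.exp (u * y * Complex.I) * stableExp b (y * Complex.I)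

theorem norm_exp_mul_stableExp (b u y : ℝ) :
    ‖Complex.exp (u * y * Complex.I) * stableExp b (y * Complex.I)‖
      = ‖stableExp b (y * Complex.I)‖ := by
  rw [norm_mul, ← Complex.ofReal_mul, Complex.norm_exp_ofReal_mul_I, one_mul]

theorem continuous_stableInv {b : ℝ} (hb0 : 0 < b) (hb1 : b < 1) : Continuous (stableInv b) := by
  refine continuous_const.mul (continuous_of_dominated
    (bound := fun y => ‖stableExp b (y * Complex.I)‖) (fun u => ?_) (fun u => ?_)
    (integrable_stableExp_I hb0 hb1).norm ?_)
  · exact ((by fun_prop : Continuous fun y : ℝ => Complex.exp (u * y * Complex.I)).mul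
      (continuous_stableExp_I hb0)).aestronglyMeasurable
  · exact Eventually.of_forall fun y => (norm_exp_mul_stableExp b u y).le
  · exact Eventually.of_forall fun y => by fun_prop

theorem norm_stableInv_le (b u : ℝ) :
    ‖stableInv b u‖ ≤ (2 * Real.pi)⁻¹ * ∫ y : ℝ, ‖stableExp b (y * Complex.I)‖ := by
  have hpi := Real.pi_pos
  rw [stableInv, norm_mul, Complex.norm_real, Real.norm_of_nonneg (by positivity)]
  gcongr
  refine (norm_integral_le_integral_norm _).trans (le_of_eq ?_)
  simp_rw [norm_exp_mul_stableExp]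

theorem integrableOn_exp_neg_mul {l : ℝ} (hl : 0 < l) :
    IntegrableOn (fun u : ℝ => Real.exp (-(l * u))) (Ioi 0) := by
  simpa using integrableOn_exp_neg_mul_pow 0 hl

theorem integrableOn_exp_neg_mul_stableInv {b : ℝ} (hb0 : 0 < b) (hb1 : b < 1) {l : ℝ}
    (hl : 0 < l) :
    IntegrableOn (fun u : ℝ => (Real.exp (-(l * u)) : ℂ) * stableInv b u) (Ioi 0) := by
  simp_rw [mul_comm _ (stableInv b _)]
  exact (integrableOn_exp_neg_mul hl).ofReal.bdd_mul
    (continuous_stableInv hb0 hb1).aestronglyMeasurable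
    (Eventually.of_forall fun u => norm_stableInv_le b u)

/-- By Fubini the `u`-integral is done first and gives `1 / (l - i y)`; Cauchy's formula evaluates
what remains. -/
theorem integral_exp_neg_mul_stableInv {b : ℝ} (hb0 : 0 < b) (hb1 : b < 1) {l : ℝ}
    (hl : 0 < l) :
    ∫ u in Ioi (0 : ℝ), (Real.exp (-(l * u)) : ℂ) * stableInv b u = Real.exp (-l ^ b) := by
  have hint : Integrable (Function.uncurry fun u y : ℝ => (Real.exp (-(l * u)) : ℂ) *
      (Complex.exp (u * y * Complex.I) * stableExp b (y * Complex.I)))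
      ((volume.restrict (Ioi 0)).prod volume) := by
    have h1 := ((integrableOn_exp_neg_mul hl).ofReal (𝕜 := ℂ)).mul_prod
      (integrable_stableExp_I hb0 hb1)
    have h2 := h1.bdd_mul (c := 1) (f := fun z : ℝ × ℝ => Complex.exp (z.1 * z.2 * Complex.I))
      (by fun_prop : Continuous fun z : ℝ × ℝ =>
        Complex.exp (z.1 * z.2 * Complex.I)).aestronglyMeasurable
      (Eventually.of_forall fun z => by
        rw [← Complex.ofReal_mul, Complex.norm_exp_ofReal_mul_I])
    refine h2.congr (Eventually.of_forall fun z => ?_)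
    exact mul_left_comm _ _ _
  have hinner : ∀ y : ℝ, ∫ u in Ioi (0 : ℝ), (Real.exp (-(l * u)) : ℂ) *
      (Complex.exp (u * y * Complex.I) * stableExp b (y * Complex.I))
      = stableExp b (y * Complex.I) / (l - y * Complex.I) := by
    intro y
    have h1 := integral_exp_mul_complex_Ioi (a := (y : ℂ) * Complex.I - l) (by simpa using hl) 0
    have h2 : ∀ u : ℝ, (Real.exp (-(l * u)) : ℂ) *
        (Complex.exp (u * y * Complex.I) * stableExp b (y * Complex.I))
        = Complex.exp ((y * Complex.I - l) * u) * stableExp b (y * Complex.I) := by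
      intro u
      rw [← mul_assoc, Complex.ofReal_exp, ← Complex.exp_add]
      congr 2
      push_cast
      ring
    simp_rw [h2]
    rw [integral_mul_const, h1, Complex.ofReal_zero, mul_zero, Complex.exp_zero,
      neg_div, ← div_neg, neg_sub]
    ring
  calc ∫ u in Ioi (0 : ℝ), (Real.exp (-(l * u)) : ℂ) * stableInv b u
      = ((2 * Real.pi : ℝ) : ℂ)⁻¹ * ∫ u in Ioi (0 : ℝ), ∫ y : ℝ, (Real.exp (-(l * u)) : ℂ) *
          (Complex.exp (u * y * Complex.I) * stableExp b (y * Complex.I)) := by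
        rw [← integral_const_mul]
        refine setIntegral_congr_fun measurableSet_Ioi fun u _ => ?_
        rw [integral_const_mul, stableInv]
        push_cast
        ring
    _ = _ := by
        rw [integral_integral_swap hint]
        simp_rw [hinner]
        rw [integral_stableExp_div hb0 hb1 hl]
        push_cast
        field_simp

theorem integrableOn_exp_neg_mul_re_stableInv {b : ℝ} (hb0 : 0 < b) (hb1 : b < 1) {l : ℝ}
    (hl : 0 < l) :
    IntegrableOn (fun u : ℝ => Real.exp (-(l * u)) * (stableInv b u).re) (Ioi 0) := by
  refine (integrableOn_exp_neg_mul_stableInv hb0 hb1 hl).re.congr (Eventually.of_forall fun u => ?_)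
  exact Complex.re_ofReal_mul _ _

theorem integral_exp_neg_mul_re_stableInv {b : ℝ} (hb0 : 0 < b) (hb1 : b < 1) {l : ℝ}
    (hl : 0 < l) :
    ∫ u in Ioi (0 : ℝ), Real.exp (-(l * u)) * (stableInv b u).re = Real.exp (-l ^ b) := by
  have h := congrArg Complex.re (integral_exp_neg_mul_stableInv hb0 hb1 hl)
  have h2 := integral_re (integrableOn_exp_neg_mul_stableInv hb0 hb1 hl)
  rw [Complex.ofReal_re] at h
  rw [← h]
  refine Eq.trans ?_ h2
  exact integral_congr_ae (Eventually.of_forall fun u => (Complex.re_ofReal_mul _ _).symm)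

theorem re_stableInv_nonneg {b : ℝ} (hb0 : 0 < b) (hb1 : b < 1) {u : ℝ} (hu : 0 < u) :
    0 ≤ (stableInv b u).re := by
  have hmom : ∀ (k : ℕ) (l : ℝ), 0 < l →
      IntegrableOn (fun u => Real.exp (-(l * u)) * (u ^ k * (stableInv b u).re)) (Ioi 0) := by
    intro k
    induction k with
    | zero => simpa using fun l => integrableOn_exp_neg_mul_re_stableInv hb0 hb1
    | succ k ih =>
      intro l hl
      have := (integrableOn_laplace_mul_and_hasDerivAt ih hl).1
      refine this.congr (Eventually.of_forall fun u => ?_)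
      simp only
      ring
  refine nonneg_of_laplace_moment_nonneg (C := (2 * Real.pi)⁻¹ * ∫ y : ℝ,
    ‖stableExp b (y * Complex.I)‖) (fun u _ => ?_) hmom (fun k l hl => ?_) hu
    (Complex.continuous_re.comp (continuous_stableInv hb0 hb1)).continuousAt
  · exact (Complex.re_le_norm _).trans (norm_stableInv_le b u)
  · refine StableCone.laplace_moment_nonneg hb0 hb1 k (.term 1 0 zero_le_one le_rfl)
      (fun l => integrableOn_exp_neg_mul_re_stableInv hb0 hb1) (fun l hl => ?_) l hl
    rw [integral_exp_neg_mul_re_stableInv hb0 hb1 hl]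
    simp

/-- On `(0, x]` one has `1 ≤ e * exp (-u / x)`, so by nonnegativity the mass there is at most `e`
times the transform at `1 / x`, hence at most `e`. -/
theorem integrableOn_re_stableInv {b : ℝ} (hb0 : 0 < b) (hb1 : b < 1) :
    IntegrableOn (fun u => (stableInv b u).re) (Ioi 0) := by
  have hcont : Continuous fun u => (stableInv b u).re :=
    Complex.continuous_re.comp (continuous_stableInv hb0 hb1)
  refine integrableOn_Ioi_of_intervalIntegral_norm_bounded (l := atTop)
    (b := fun x : ℝ => x) (Real.exp 1) 0
    (fun x => (hcont.integrableOn_Icc).mono_set Ioc_subset_Icc_self) tendsto_id ?_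
  filter_upwards [eventually_gt_atTop 0] with x hx
  have hi : IntegrableOn (fun u => Real.exp 1 * (Real.exp (-(x⁻¹ * u)) * (stableInv b u).re))
      (Ioi 0) :=
    (integrableOn_exp_neg_mul_re_stableInv hb0 hb1 (by positivity)).const_mul _
  calc ∫ u in (0 : ℝ)..x, ‖(stableInv b u).re‖
      = ∫ u in Ioc 0 x, ‖(stableInv b u).re‖ := intervalIntegral.integral_of_le hx.le
    _ ≤ ∫ u in Ioc 0 x, Real.exp 1 * (Real.exp (-(x⁻¹ * u)) * (stableInv b u).re) := by
        refine setIntegral_mono_on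
          ((hcont.norm.integrableOn_Icc).mono_set Ioc_subset_Icc_self)
          (hi.mono_set Ioc_subset_Ioi_self) measurableSet_Ioc fun u hu => ?_
        have h0 := re_stableInv_nonneg hb0 hb1 hu.1
        rw [Real.norm_of_nonneg h0, ← mul_assoc, ← Real.exp_add]
        refine le_mul_of_one_le_left h0 (Real.one_le_exp ?_)
        have : x⁻¹ * u ≤ 1 := by
          rw [inv_mul_le_iff₀ hx, mul_one]; exact hu.2
        linarith
    _ ≤ ∫ u in Ioi 0, Real.exp 1 * (Real.exp (-(x⁻¹ * u)) * (stableInv b u).re) := by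
        refine setIntegral_mono_set hi ?_ Ioc_subset_Ioi_self.eventuallyLE
        refine (ae_restrict_iff' measurableSet_Ioi).mpr (Eventually.of_forall fun u hu => ?_)
        have h0 := re_stableInv_nonneg hb0 hb1 hu
        simp only [Pi.zero_apply]
        positivity
    _ = Real.exp 1 * Real.exp (-(x⁻¹) ^ b) := by
        rw [integral_const_mul, integral_exp_neg_mul_re_stableInv hb0 hb1 (by positivity)]
    _ ≤ Real.exp 1 := by
        refine mul_le_of_le_one_right (Real.exp_pos _).le (Real.exp_le_one_iff.mpr ?_)
        have : 0 ≤ (x⁻¹) ^ b := by positivity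
        linarith

theorem integral_re_stableInv {b : ℝ} (hb0 : 0 < b) (hb1 : b < 1) :
    ∫ u in Ioi (0 : ℝ), (stableInv b u).re = 1 := by
  have h1 : Tendsto (fun l : ℝ => ∫ u in Ioi (0 : ℝ), Real.exp (-(l * u)) * (stableInv b u).re)
      (𝓝[>] 0) (𝓝 (∫ u in Ioi (0 : ℝ), (stableInv b u).re)) := by
    refine tendsto_integral_filter_of_dominated_convergence (fun u => ‖(stableInv b u).re‖)
      ?_ ?_ (integrableOn_re_stableInv hb0 hb1).norm ?_
    · filter_upwards [self_mem_nhdsWithin] with l hl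
      exact (integrableOn_exp_neg_mul_re_stableInv hb0 hb1 hl).aestronglyMeasurable
    · filter_upwards [self_mem_nhdsWithin] with l hl
      refine (ae_restrict_iff' measurableSet_Ioi).mpr (Eventually.of_forall fun u hu => ?_)
      rw [norm_mul, Real.norm_of_nonneg (Real.exp_pos _).le]
      refine mul_le_of_le_one_left (norm_nonneg _) (Real.exp_le_one_iff.mpr ?_)
      have := mul_pos (show 0 < l from hl) (show 0 < u from hu)
      linarith
    · refine Eventually.of_forall fun u => ?_
      have : Continuous fun l : ℝ => Real.exp (-(l * u)) * (stableInv b u).re := by fun_prop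
      simpa using (this.tendsto 0).mono_left nhdsWithin_le_nhds
  have h2 : Tendsto (fun l : ℝ => ∫ u in Ioi (0 : ℝ), Real.exp (-(l * u)) * (stableInv b u).re)
      (𝓝[>] 0) (𝓝 1) := by
    have h3 : Tendsto (fun l : ℝ => Real.exp (-l ^ b)) (𝓝[>] 0) (𝓝 1) := by
      have : ContinuousAt (fun l : ℝ => Real.exp (-l ^ b)) 0 :=
        (Real.continuousAt_rpow_const 0 b (Or.inr hb0.le)).neg.rexp
      have h := this.tendsto
      rw [Real.zero_rpow hb0.ne', neg_zero, Real.exp_zero] at h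
      exact h.mono_left nhdsWithin_le_nhds
    refine h3.congr' ?_
    filter_upwards [self_mem_nhdsWithin] with l hl
    rw [integral_exp_neg_mul_re_stableInv hb0 hb1 hl]
  exact tendsto_nhds_unique h1 h2

theorem isSubordinatorDensity_stableInv {α : ℝ} (hα₀ : 0 < α) (hα₂ : α < 2) :
    IsSubordinatorDensity α 1 (fun u => (stableInv (α / 2) u).re) where
  nonneg u hu := re_stableInv_nonneg (by linarith) (by linarith) hu
  integrableOn := integrableOn_re_stableInv (by linarith) (by linarith)
  laplace l hl := by
    rw [one_mul]
    rcases hl.eq_or_lt with rfl | hl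
    · rw [Real.zero_rpow (by positivity)]
      simpa using integral_re_stableInv (b := α / 2) (by linarith) (by linarith)
    · exact integral_exp_neg_mul_re_stableInv (by linarith) (by linarith) hl

theorem IsSubordinatorDensity.rescale {α T : ℝ} (hT : 0 < T) {f : ℝ → ℝ}
    (hf : IsSubordinatorDensity α 1 f) :
    IsSubordinatorDensity α (T ^ (α / 2)) (fun u => T⁻¹ * f (T⁻¹ * u)) where
  nonneg u hu := mul_nonneg (inv_pos.mpr hT).le (hf.nonneg _ (by positivity))
  integrableOn := by
    refine Integrable.const_mul ?_ _
    have := (integrableOn_Ioi_comp_mul_left_iff f 0 (inv_pos.mpr hT)).mpr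
      (by simpa using hf.integrableOn)
    exact this
  laplace l hl := by
    have h := integral_comp_mul_left_Ioi (fun s => T⁻¹ * (Real.exp (-(l * T * s)) * f s)) 0
      (inv_pos.mpr hT)
    rw [mul_zero, integral_const_mul, integral_const_mul, hf.laplace (l * T) (by positivity), inv_inv, smul_eq_mul,
      mul_inv_cancel_left₀ hT.ne', one_mul, Real.mul_rpow hl hT.le, mul_comm (l ^ _)] at h
    rw [← h, ← integral_const_mul]
    refine setIntegral_congr_fun measurableSet_Ioi fun u _ => ?_
    rw [mul_assoc l T, mul_inv_cancel_left₀ hT.ne']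
    ring

end StableDensity

/-! ### Uniqueness and convolution for Laplace transforms -/

section LaplaceUniqueness

/-- Two finite measures whose moment generating functions are finite and equal on a neighbourhood
of `-∞` containing `0` are equal. -/
theorem MeasureTheory.Measure.ext_of_mgf_eqOn_Iio {μ ν : Measure ℝ} [IsFiniteMeasure μ]
    [IsFiniteMeasure ν] {a : ℝ} (ha : 0 < a)
    (hμ : ∀ t < a, Integrable (fun x => Real.exp (t * x)) μ)
    (hν : ∀ t < a, Integrable (fun x => Real.exp (t * x)) ν)
    (h : ∀ t < a, ∫ x, Real.exp (t * x) ∂μ = ∫ x, Real.exp (t * x) ∂ν) : μ = ν := by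
  -- Both complex moment generating functions are analytic on this half plane and agree at real
  -- points near `0`. As `a > 0` it contains the imaginary axis, where they are the characteristic
  -- functions.
  set U : Set ℂ := {z : ℂ | z.re < a} with hU
  have hsub : ∀ ρ : Measure ℝ, (∀ t < a, Integrable (fun x => Real.exp (t * x)) ρ) →
      U ⊆ {z : ℂ | z.re ∈ interior (ProbabilityTheory.integrableExpSet id ρ)} := by
    intro ρ hρ z hz
    exact mem_interior.mpr ⟨Iio a, fun t ht => hρ t ht, isOpen_Iio, hz⟩
  have hAμ := (ProbabilityTheory.analyticOnNhd_complexMGF (X := id) (μ := μ)).mono (hsub μ hμ)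
  have hAν := (ProbabilityTheory.analyticOnNhd_complexMGF (X := id) (μ := ν)).mono (hsub ν hν)
  have hconv : IsPreconnected U :=
    ((convex_Iio a).linear_preimage Complex.reLm).isPreconnected
  have hfreq : ∃ᶠ z in 𝓝[≠] (0 : ℂ),
      ProbabilityTheory.complexMGF id μ z = ProbabilityTheory.complexMGF id ν z := by
    have ht : Tendsto (fun t : ℝ => (t : ℂ)) (𝓝[≠] 0) (𝓝[≠] 0) := by
      refine tendsto_nhdsWithin_iff.mpr ⟨?_, ?_⟩
      · have := (Complex.continuous_ofReal.tendsto 0).mono_left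
          (nhdsWithin_le_nhds (s := {(0 : ℝ)}ᶜ))
        simpa using this
      · filter_upwards [self_mem_nhdsWithin] with t ht
        simpa using ht
    refine ht.frequently (Eventually.frequently ?_)
    filter_upwards [nhdsWithin_le_nhds (Iio_mem_nhds ha)] with t hta
    rw [ProbabilityTheory.complexMGF_ofReal, ProbabilityTheory.complexMGF_ofReal]
    exact_mod_cast h t hta
  have heq := hAμ.eqOn_of_preconnected_of_frequently_eq hAν hconv (by simpa [hU] using ha) hfreq
  refine Measure.ext_of_charFun (funext fun t => ?_)
  rw [← ProbabilityTheory.complexMGF_id_mul_I, ← ProbabilityTheory.complexMGF_id_mul_I]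
  exact heq (by simpa [hU] using ha)

/-- A nonnegative function on `(0, ∞)` with finite Laplace transform. -/
structure HasLaplaceTransform (f : ℝ → ℝ) : Prop where
  nonneg : ∀ u, 0 < u → 0 ≤ f u
  integrableOn : ∀ l : ℝ, 0 < l → IntegrableOn (fun u => Real.exp (-(l * u)) * f u) (Ioi 0)

/-- The measure on `(0, ∞)` with density `exp (-u) * f u`. -/
noncomputable def tiltedMeasure (f : ℝ → ℝ) : Measure ℝ :=
  (volume.restrict (Ioi (0 : ℝ))).withDensity fun u => ENNReal.ofReal (Real.exp (-(1 * u)) * f u)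

variable {f g k : ℝ → ℝ}

/-- The tilt by `exp (-u)` gives finite measures even for nonintegrable functions such as `u ^
(-b)`. With `l = 1 - t`, transforms on `l > 0` become moment generating functions on `t < 1`, a
range containing a neighbourhood of `0`. -/
theorem HasLaplaceTransform.isFiniteMeasure (hf : HasLaplaceTransform f) :
    IsFiniteMeasure (tiltedMeasure f) :=
  isFiniteMeasure_withDensity_ofReal (hf.integrableOn 1 one_pos).2

theorem HasLaplaceTransform.aemeasurable (hf : HasLaplaceTransform f) :
    AEMeasurable (fun u => ENNReal.ofReal (Real.exp (-(1 * u)) * f u))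
      (volume.restrict (Ioi (0 : ℝ))) :=
  (hf.integrableOn 1 one_pos).aemeasurable.ennreal_ofReal

theorem HasLaplaceTransform.smul_exp_ae_eq (hf : HasLaplaceTransform f) (t : ℝ) :
    (fun u => (ENNReal.ofReal (Real.exp (-(1 * u)) * f u)).toReal • Real.exp (t * u))
      =ᵐ[volume.restrict (Ioi (0 : ℝ))] fun u => Real.exp (-((1 - t) * u)) * f u := by
  refine (ae_restrict_iff' measurableSet_Ioi).mpr (Eventually.of_forall fun u hu => ?_)
  have := hf.nonneg u hu
  dsimp only
  rw [ENNReal.toReal_ofReal (by positivity), smul_eq_mul, mul_right_comm, ← Real.exp_add]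
  congr 2
  ring

theorem HasLaplaceTransform.integrable_exp (hf : HasLaplaceTransform f) {t : ℝ} (ht : t < 1) :
    Integrable (fun u => Real.exp (t * u)) (tiltedMeasure f) := by
  rw [tiltedMeasure, integrable_withDensity_iff_integrable_smul₀' hf.aemeasurable
    (Eventually.of_forall fun _ => ENNReal.ofReal_lt_top)]
  exact (hf.integrableOn (1 - t) (by linarith)).congr (hf.smul_exp_ae_eq t).symm

theorem HasLaplaceTransform.integral_exp (hf : HasLaplaceTransform f) (t : ℝ) :
    ∫ u, Real.exp (t * u) ∂(tiltedMeasure f)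
      = ∫ u in Ioi (0 : ℝ), Real.exp (-((1 - t) * u)) * f u := by
  rw [tiltedMeasure, integral_withDensity_eq_integral_toReal_smul₀ hf.aemeasurable
    (Eventually.of_forall fun _ => ENNReal.ofReal_lt_top)]
  exact integral_congr_ae (hf.smul_exp_ae_eq t)

/-- Functions with the same Laplace transform agree almost everywhere. -/
theorem HasLaplaceTransform.ae_eq (hf : HasLaplaceTransform f) (hg : HasLaplaceTransform g)
    (h : ∀ l : ℝ, 0 < l → ∫ u in Ioi (0 : ℝ), Real.exp (-(l * u)) * f u
      = ∫ u in Ioi (0 : ℝ), Real.exp (-(l * u)) * g u) :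
    f =ᵐ[volume.restrict (Ioi (0 : ℝ))] g := by
  have := hf.isFiniteMeasure
  have := hg.isFiniteMeasure
  have hm : tiltedMeasure f = tiltedMeasure g :=
    Measure.ext_of_mgf_eqOn_Iio one_pos (fun t ht => hf.integrable_exp ht)
      (fun t ht => hg.integrable_exp ht)
      (fun t ht => by rw [hf.integral_exp, hg.integral_exp, h _ (by linarith)])
  have hfin : ∫⁻ u in Ioi (0 : ℝ), ENNReal.ofReal (Real.exp (-(1 * u)) * f u) ≠ ⊤ :=
    (hf.integrableOn 1 one_pos).lintegral_lt_top.ne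
  have h1 := (withDensity_eq_iff hf.aemeasurable hg.aemeasurable hfin).mp hm
  filter_upwards [h1, ae_restrict_mem measurableSet_Ioi] with u hu hu0
  have hfu := hf.nonneg u hu0
  have hgu := hg.nonneg u hu0
  rw [ENNReal.ofReal_eq_ofReal_iff (by positivity) (by positivity)] at hu
  exact mul_left_cancel₀ (Real.exp_pos _).ne' hu

/-- If the Laplace transform of `g` is the product of those of `f` and `k`, then the measure with
density `g` is the convolution of those with densities `f` and `k`. -/
theorem HasLaplaceTransform.tiltedMeasure_eq_conv (hf : HasLaplaceTransform f)
    (hg : HasLaplaceTransform g) (hk : HasLaplaceTransform k)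
    (h : ∀ l : ℝ, 0 < l → ∫ u in Ioi (0 : ℝ), Real.exp (-(l * u)) * g u
      = (∫ u in Ioi (0 : ℝ), Real.exp (-(l * u)) * f u) *
        ∫ u in Ioi (0 : ℝ), Real.exp (-(l * u)) * k u) :
    tiltedMeasure g = (tiltedMeasure f).conv (tiltedMeasure k) := by
  have := hf.isFiniteMeasure
  have := hg.isFiniteMeasure
  have := hk.isFiniteMeasure
  have e : ∀ t : ℝ, (fun z : ℝ × ℝ => Real.exp (t * (z.1 + z.2)))
      = fun z : ℝ × ℝ => Real.exp (t * z.1) * Real.exp (t * z.2) := by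
    intro t
    ext z
    rw [mul_add, Real.exp_add]
  refine Measure.ext_of_mgf_eqOn_Iio one_pos (fun t ht => hg.integrable_exp ht)
    (fun t ht => ?_) (fun t ht => ?_)
  · rw [Measure.conv, integrable_map_measure (by fun_prop) (by fun_prop)]
    have := (hf.integrable_exp ht).mul_prod (hk.integrable_exp ht)
    rw [← e t] at this
    exact this
  · rw [Measure.conv, integral_map (by fun_prop) (by fun_prop), e t,
      integral_prod_mul (fun x => Real.exp (t * x)) (fun x => Real.exp (t * x)), hf.integral_exp, hg.integral_exp, hk.integral_exp, h _ (by linarith)]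

/-- The convolution gives `(a, c)` the mass `∫ κ (a - x, c - x) dμ(x)`, with `κ` the tilted measure
of `k`. For `x < c` that interval meets `(0, ∞)` in a nonempty open set, which `κ` charges. -/
theorem ae_le_of_conv_Ioo_eq_zero {μ : Measure ℝ} [SFinite μ] (hk : HasLaplaceTransform k)
    (hk0 : ∀ u, 0 < u → 0 < k u) {a c : ℝ} (hac : a < c)
    (h : (μ.conv (tiltedMeasure k)) (Ioo a c) = 0) : ∀ᵐ x ∂μ, c ≤ x := by
  have := hk.isFiniteMeasure
  rw [← lintegral_indicator_one measurableSet_Ioo, Measure.lintegral_conv (by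
    exact (measurable_one.indicator measurableSet_Ioo)), lintegral_eq_zero_iff (by
    exact Measurable.lintegral_prod_right'
      (f := fun z : ℝ × ℝ => (Ioo a c).indicator (1 : ℝ → ENNReal) (z.1 + z.2))
      ((measurable_one.indicator measurableSet_Ioo).comp (by fun_prop)))] at h
  filter_upwards [h] with x hx
  by_contra! hxc
  have hac' : volume.restrict (Ioi (0 : ℝ)) ≪ tiltedMeasure k := by
    refine withDensity_absolutelyContinuous' hk.aemeasurable ?_
    filter_upwards [ae_restrict_mem measurableSet_Ioi] with u hu
    have := hk0 u hu
    rw [ne_eq, ENNReal.ofReal_eq_zero, not_le]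
    positivity
  have h1 : (tiltedMeasure k) (Ioo (a - x) (c - x)) = 0 := by
    rw [← lintegral_indicator_one measurableSet_Ioo, ← Pi.zero_apply (M := fun _ => ENNReal) x,
      ← hx]
    refine lintegral_congr fun y => ?_
    simp only [indicator, mem_Ioo, sub_lt_iff_lt_add', lt_sub_iff_add_lt', Pi.one_apply]
  have h2 := hac' h1
  rw [Measure.restrict_apply measurableSet_Ioo, inter_comm, Ioi_inter_Ioo, Real.volume_Ioo,
    ENNReal.ofReal_eq_zero] at h2
  rcases max_choice 0 (a - x) with hm | hm <;> (rw [hm] at h2; linarith)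

end LaplaceUniqueness

/-! ### Full support of the stable density -/

section FullSupport

variable {α : ℝ} {f : ℝ → ℝ}

theorem IsSubordinatorDensity.hasLaplaceTransform {t : ℝ} (hf : IsSubordinatorDensity α t f) :
    HasLaplaceTransform f where
  nonneg := hf.nonneg
  integrableOn l hl := by
    refine hf.integrableOn.bdd_mul (c := 1)
      (by fun_prop : Continuous fun u : ℝ => Real.exp (-(l * u))).aestronglyMeasurable ?_
    filter_upwards [ae_restrict_mem measurableSet_Ioi] with u hu
    rw [Real.norm_of_nonneg (Real.exp_pos _).le]
    have := mul_pos hl (show 0 < u from hu)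
    exact Real.exp_le_one_iff.mpr (by linarith)

theorem IsSubordinatorDensity.ae_eq {t : ℝ} {g : ℝ → ℝ} (hf : IsSubordinatorDensity α t f)
    (hg : IsSubordinatorDensity α t g) : f =ᵐ[volume.restrict (Ioi (0 : ℝ))] g :=
  hf.hasLaplaceTransform.ae_eq hg.hasLaplaceTransform fun l hl => by
    rw [hf.laplace l hl.le, hg.laplace l hl.le]

theorem IsSubordinatorDensity.integral_eq_one {t : ℝ} (hα₀ : 0 < α)
    (hf : IsSubordinatorDensity α t f) : ∫ u in Ioi (0 : ℝ), f u = 1 := by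
  have := hf.laplace 0 le_rfl
  rw [Real.zero_rpow (by positivity)] at this
  simpa using this

theorem HasLaplaceTransform.mul_self (hf : HasLaplaceTransform f) :
    HasLaplaceTransform fun u => u * f u where
  nonneg u hu := mul_nonneg hu.le (hf.nonneg u hu)
  integrableOn _ hl := (integrableOn_laplace_mul_and_hasDerivAt hf.integrableOn hl).1

theorem IsSubordinatorDensity.laplace_mul_self (hf : IsSubordinatorDensity α 1 f) {l : ℝ}
    (hl : 0 < l) :
    ∫ u in Ioi (0 : ℝ), Real.exp (-(l * u)) * (u * f u)
      = Real.exp (-l ^ (α / 2)) * (α / 2 * l ^ (α / 2 - 1)) := by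
  have h1 := (integrableOn_laplace_mul_and_hasDerivAt hf.hasLaplaceTransform.integrableOn hl).2
  have h2 : HasDerivAt (fun l : ℝ => Real.exp (-l ^ (α / 2)))
      (Real.exp (-l ^ (α / 2)) * -(α / 2 * l ^ (α / 2 - 1))) l :=
    (Real.hasDerivAt_rpow_const (p := α / 2) (Or.inl hl.ne')).fun_neg.exp
  have h3 := h2.congr_of_eventuallyEq
    (f₁ := fun l => ∫ u in Ioi (0 : ℝ), Real.exp (-(l * u)) * f u)
    (by
      filter_upwards [Ioi_mem_nhds hl] with l' hl'
      rw [hf.laplace l' (le_of_lt hl'), one_mul])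
  have := h1.unique h3
  linarith

theorem laplace_rpow_neg {b l : ℝ} (hb : b < 1) (hl : 0 < l) :
    ∫ u in Ioi (0 : ℝ), Real.exp (-(l * u)) * u ^ (-b) = l ^ (b - 1) * Real.Gamma (1 - b) := by
  have h := Real.integral_rpow_mul_exp_neg_mul_Ioi (a := 1 - b) (r := l) (by linarith) hl
  rw [one_div, Real.inv_rpow hl.le, ← Real.rpow_neg hl.le, neg_sub] at h
  rw [← h]
  refine setIntegral_congr_fun measurableSet_Ioi fun u _ => ?_
  rw [mul_comm]
  congr 2
  ring

theorem hasLaplaceTransform_rpow_neg {b C : ℝ} (hb : b < 1) (hC : 0 ≤ C) :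
    HasLaplaceTransform fun u => C * u ^ (-b) where
  nonneg u hu := by positivity
  integrableOn l hl := by
    have h : IntegrableOn (fun u => Real.exp (-(l * u)) * u ^ (-b)) (Ioi 0) := by
      refine not_imp_comm.mp integral_undef ?_
      rw [laplace_rpow_neg hb hl]
      have := Real.Gamma_pos_of_pos (s := 1 - b) (by linarith)
      positivity
    refine (h.const_mul C).congr (Eventually.of_forall fun u => ?_)
    exact mul_left_comm _ _ _

/-- The stable density charges every open interval of `(0, ∞)`. -/
theorem IsSubordinatorDensity.setIntegral_Ioo_pos (hα₀ : 0 < α) (hα₂ : α < 2)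
    (hf : IsSubordinatorDensity α 1 f) {a c : ℝ} (ha : 0 ≤ a) (hac : a < c) :
    0 < ∫ u in Ioo a c, f u := by
  have hsub : Ioo a c ⊆ Ioi 0 := fun u hu => lt_of_le_of_lt ha hu.1
  have hnn : 0 ≤ᵐ[volume.restrict (Ioo a c)] f := by
    filter_upwards [ae_restrict_mem measurableSet_Ioo] with u hu using hf.nonneg u (hsub hu)
  refine lt_of_le_of_ne (integral_nonneg_of_ae hnn) fun h0 => ?_
  have hL := hf.hasLaplaceTransform
  set b := α / 2 with hb
  have hb0 : 0 < b := by positivity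
  have hb1 : b < 1 := by rw [hb]; linarith
  have hΓ := Real.Gamma_pos_of_pos (s := 1 - b) (by linarith)
  -- Normalised so that `C * u ^ (-b)` has Laplace transform `b * l ^ (b - 1)`, the factor in
  -- `laplace_mul_self`.
  set C := b / Real.Gamma (1 - b) with hC
  have hC0 : 0 < C := by positivity
  have hk := hasLaplaceTransform_rpow_neg hb1 hC0.le
  have hconv := hL.tiltedMeasure_eq_conv hL.mul_self hk fun l hl => by
    rw [hf.laplace_mul_self hl, hf.laplace l hl.le, one_mul, ← hb]
    simp_rw [mul_left_comm _ C]
    rw [integral_const_mul, laplace_rpow_neg hb1 hl, hC]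
    field_simp
  have hnull : (tiltedMeasure fun u => u * f u) (Ioo a c) = 0 := by
    rw [tiltedMeasure, withDensity_apply _ measurableSet_Ioo, Measure.restrict_restrict_of_subset
      hsub]
    have hz := (setIntegral_eq_zero_iff_of_nonneg_ae hnn (hf.integrableOn.mono_set hsub)).mp h0.symm
    refine (lintegral_congr_ae ?_).trans lintegral_zero
    filter_upwards [hz] with u hu
    rw [hu]
    simp
  rw [hconv] at hnull
  have := hL.isFiniteMeasure
  have hsupp := ae_le_of_conv_Ioo_eq_zero hk
    (fun u hu => mul_pos hC0 (Real.rpow_pos_of_pos hu _)) hac hnull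
  rw [tiltedMeasure, ae_withDensity_iff' hL.aemeasurable] at hsupp
  have hc : 0 < c := lt_of_le_of_lt ha hac
  -- All the mass of `f` now lies in `[c, ∞)`, so its transform is at most `exp (-l c)`. Since `b <
  -- 1`, this fails for large `l`.
  have hbound : ∀ l : ℝ, 0 < l → l * c ≤ l ^ b := by
    intro l hl
    have h1 : ∫ u in Ioi (0 : ℝ), Real.exp (-(l * u)) * f u
        ≤ ∫ u in Ioi (0 : ℝ), Real.exp (-(l * c)) * f u := by
      refine integral_mono_ae (hL.integrableOn l hl) (hf.integrableOn.const_mul _) ?_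
      filter_upwards [hsupp, ae_restrict_mem measurableSet_Ioi] with u hu hu0
      rcases (hf.nonneg u hu0).eq_or_lt with h | h
      · simp [← h]
      · have : c ≤ u := hu (by
          rw [ne_eq, ENNReal.ofReal_eq_zero, not_le]
          positivity)
        gcongr
    rw [integral_const_mul, hf.integral_eq_one hα₀, hf.laplace l hl.le, mul_one, one_mul,
      Real.exp_le_exp] at h1
    linarith
  have hlim : Tendsto (fun l : ℝ => l ^ (1 - b)) atTop atTop :=
    tendsto_rpow_atTop (by linarith)
  obtain ⟨l, hl1, hl⟩ := ((hlim.eventually_gt_atTop c⁻¹).and (eventually_gt_atTop 0)).exists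
  have h2 := hbound l hl
  have h3 : l ^ (1 - b) * l ^ b = l := by
    rw [← Real.rpow_add hl]; simp
  have h4 : 0 < l ^ b := Real.rpow_pos_of_pos hl b
  have h5 : 1 < l ^ (1 - b) * c := by rwa [inv_lt_iff_one_lt_mul₀ hc] at hl1
  nlinarith

end FullSupport

/-! ### The chosen density and its scaling -/

section SubordinatorDensity

variable {α : ℝ}

/-- This excludes the default value `0` of `subordinatorDensity`. -/
theorem exists_isSubordinatorDensity (hα₀ : 0 < α) (hα₂ : α < 2) {t : ℝ} (ht : 0 < t) :
    ∃ f, IsSubordinatorDensity α t f := by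
  have h := (isSubordinatorDensity_stableInv hα₀ hα₂).rescale (Real.rpow_pos_of_pos ht (2 / α))
  rw [← Real.rpow_mul ht.le, show 2 / α * (α / 2) = 1 by field_simp, Real.rpow_one] at h
  exact ⟨_, h⟩

theorem isSubordinatorDensity_subordinatorDensity (hα₀ : 0 < α) (hα₂ : α < 2) {t : ℝ}
    (ht : 0 < t) : IsSubordinatorDensity α t (subordinatorDensity α t) := by
  have h := exists_isSubordinatorDensity hα₀ hα₂ ht
  rw [subordinatorDensity, dif_pos h]
  exact h.choose_spec

/-- The densities at different times are independent choices, so self-similarity is available only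
almost everywhere, through uniqueness. -/
theorem subordinatorDensity_ae_eq_rescale (hα₀ : 0 < α) (hα₂ : α < 2) {t : ℝ} (ht : 0 < t) :
    subordinatorDensity α t =ᵐ[volume.restrict (Ioi (0 : ℝ))]
      fun u => (t ^ (2 / α))⁻¹ * subordinatorDensity α 1 ((t ^ (2 / α))⁻¹ * u) := by
  have h := (isSubordinatorDensity_subordinatorDensity hα₀ hα₂ one_pos).rescale
    (Real.rpow_pos_of_pos ht (2 / α))
  rw [← Real.rpow_mul ht.le, show 2 / α * (α / 2) = 1 by field_simp, Real.rpow_one] at h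
  exact (isSubordinatorDensity_subordinatorDensity hα₀ hα₂ ht).ae_eq h

end SubordinatorDensity

/-! ### Limit of the annulus mass -/

section AnnulusMass

variable {V : Type*} {G : SimpleGraph V} [G.LocallyFinite] {q : ℕ} {α : ℝ}

theorem exists_finset_coe_eq_annulus (hC : G.Connected) (α : ℝ) (o : V) (A₁ A₂ t : ℝ) :
    ∃ R : Finset V, (R : Set V) = annulus G α o A₁ A₂ t := by
  have hfin : (annulus G α o A₁ A₂ t).Finite :=
    (finite_setOf_dist_le hC o ⌊A₂ * t ^ (2 / α)⌋₊).subset fun x hx => Nat.le_floor hx.2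
  exact ⟨hfin.toFinset, hfin.coe_toFinset⟩

/-- The annulus as a finite set. -/
noncomputable def annulusFinset (hC : G.Connected) (α : ℝ) (o : V) (A₁ A₂ t : ℝ) : Finset V :=
  (exists_finset_coe_eq_annulus hC α o A₁ A₂ t).choose

theorem coe_annulusFinset (hC : G.Connected) (α : ℝ) (o : V) (A₁ A₂ t : ℝ) :
    (annulusFinset hC α o A₁ A₂ t : Set V) = annulus G α o A₁ A₂ t :=
  (exists_finset_coe_eq_annulus hC α o A₁ A₂ t).choose_spec

theorem mem_annulusFinset (hC : G.Connected) {o x : V} {A₁ A₂ t : ℝ} :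
    x ∈ annulusFinset hC α o A₁ A₂ t ↔
      A₁ * t ^ (2 / α) ≤ (G.dist o x : ℝ) ∧ (G.dist o x : ℝ) ≤ A₂ * t ^ (2 / α) := by
  rw [← Finset.mem_coe, coe_annulusFinset]
  rfl

theorem integrableOn_heatKernel_mul (hG : G.IsRegularOfDegree (q + 1)) (o x : V) {f : ℝ → ℝ}
    (hf : IntegrableOn f (Ioi 0)) :
    IntegrableOn (fun u => heatKernel hG o u x * f u) (Ioi 0) := by
  refine hf.bdd_mul (c := 1) (continuous_heatKernel hG o x).aestronglyMeasurable ?_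
  filter_upwards [ae_restrict_mem measurableSet_Ioi] with u hu
  rw [Real.norm_of_nonneg (heatKernel_nonneg hG o (le_of_lt hu) x)]
  simpa using sum_heatKernel_le_one hG o (le_of_lt hu) {x}

/-- The mass of the annulus as an average over the rescaled subordinator. -/
theorem annulusMass_eq_integral (hC : G.Connected) (hG : G.IsRegularOfDegree (q + 1)) (o : V)
    (hα₀ : 0 < α) (hα₂ : α < 2) (A₁ A₂ : ℝ) {t : ℝ} (ht : 0 < t) :
    annulusMass hG α o A₁ A₂ t = ∫ s in Ioi (0 : ℝ),
      (∑ x ∈ annulusFinset hC α o A₁ A₂ t, heatKernel hG o (t ^ (2 / α) * s) x)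
        * subordinatorDensity α 1 s := by
  set T := t ^ (2 / α) with hT
  have hT0 : 0 < T := Real.rpow_pos_of_pos ht _
  set R := annulusFinset hC α o A₁ A₂ t with hR
  have h1 : annulusMass hG α o A₁ A₂ t = ∑ x ∈ R, stableKernel hG α o t x := by
    rw [annulusMass, ← coe_annulusFinset hC, Finset.tsum_subtype']
  rw [h1]
  simp only [stableKernel]
  rw [← integral_finsetSum _ fun x _ => integrableOn_heatKernel_mul hG o x
    (isSubordinatorDensity_subordinatorDensity hα₀ hα₂ ht).integrableOn]
  have h2 := integral_comp_mul_left_Ioi (fun s => (∑ x ∈ R, heatKernel hG o (T * s) x)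
        * subordinatorDensity α 1 s) 0 (inv_pos.mpr hT0)
  rw [mul_zero, inv_inv, smul_eq_mul, ← inv_mul_eq_iff_eq_mul₀ hT0.ne',
    ← integral_const_mul] at h2
  rw [← h2]
  refine integral_congr_ae ?_
  filter_upwards [subordinatorDensity_ae_eq_rescale hα₀ hα₂ ht] with u hu
  rw [← Finset.sum_mul, hu, mul_inv_cancel_left₀ hT0.ne']
  ring

theorem one_le_mul_sq_of_le_abs {δ y : ℝ} (hδ : 0 < δ) (h : δ ≤ |y|) : 1 ≤ 1 / δ ^ 2 * y ^ 2 := by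
  rw [one_div, ← sq_abs y, inv_mul_eq_div, one_le_div (by positivity)]
  exact pow_le_pow_left₀ hδ.le h 2

/-- This is the Chebyshev bound at time `T s` with tolerance `δ T`: second moment `4 T s` over `(δ
T) ^ 2`, of order `1 / T`. -/
theorem tendsto_const_div_mul_rpow (hα₀ : 0 < α) (δ s : ℝ) :
    Tendsto (fun t : ℝ => 1 / (δ * t ^ (2 / α)) ^ 2 * (4 * (t ^ (2 / α) * s))) atTop (𝓝 0) := by
  have h1 : Tendsto (fun t : ℝ => t ^ (2 / α)) atTop atTop := tendsto_rpow_atTop (by positivity)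
  have h2 : Tendsto (fun T : ℝ => 4 * s / δ ^ 2 / T) atTop (𝓝 0) :=
    tendsto_const_nhds.div_atTop tendsto_id
  refine (h2.comp h1).congr' ?_
  filter_upwards [eventually_gt_atTop 0] with t ht
  have : 0 < t ^ (2 / α) := Real.rpow_pos_of_pos ht _
  simp only [Function.comp]
  field_simp

theorem tendsto_sum_heatKernel_zero (hq : 2 ≤ q) (hT : G.IsTree)
    (hG : G.IsRegularOfDegree (q + 1)) (o : V) (hα₀ : 0 < α) {A₁ A₂ s δ : ℝ} (hs : 0 < s)
    (hδ : 0 < δ) (h : ∀ r, A₁ ≤ r → r ≤ A₂ → δ ≤ |r - walkSpeed q * s|) :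
    Tendsto (fun t => ∑ x ∈ annulusFinset hT.connected α o A₁ A₂ t,
      heatKernel hG o (t ^ (2 / α) * s) x) atTop (𝓝 0) := by
  refine squeeze_zero' ?_ ?_ (tendsto_const_div_mul_rpow hα₀ δ s)
  · filter_upwards [eventually_gt_atTop 0] with t ht
    exact sum_heatKernel_nonneg hG o (by positivity) _
  · filter_upwards [eventually_gt_atTop 0] with t ht
    have hT0 : 0 < t ^ (2 / α) := Real.rpow_pos_of_pos ht _
    refine sum_heatKernel_le hq hT hG o (by positivity) (by positivity) _ fun x hx => ?_
    rw [mem_annulusFinset] at hx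
    refine one_le_mul_sq_of_le_abs (by positivity) ?_
    have := h ((G.dist o x : ℝ) / t ^ (2 / α)) ((le_div_iff₀ hT0).mpr hx.1)
      ((div_le_iff₀ hT0).mpr hx.2)
    calc δ * t ^ (2 / α)
        ≤ |(G.dist o x : ℝ) / t ^ (2 / α) - walkSpeed q * s| * |t ^ (2 / α)| := by
          rw [abs_of_pos hT0]; gcongr
      _ = _ := by
          rw [← abs_mul]
          congr 1
          field_simp

theorem tendsto_sum_heatKernel_one (hq : 2 ≤ q) (hT : G.IsTree)
    (hG : G.IsRegularOfDegree (q + 1)) (o : V) (hα₀ : 0 < α) {A₁ A₂ s δ : ℝ} (hs : 0 < s)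
    (hδ : 0 < δ) (h : ∀ r, r < A₁ ∨ A₂ < r → δ ≤ |r - walkSpeed q * s|) :
    Tendsto (fun t => ∑ x ∈ annulusFinset hT.connected α o A₁ A₂ t,
      heatKernel hG o (t ^ (2 / α) * s) x) atTop (𝓝 1) := by
  have hlow := (tendsto_const_div_mul_rpow hα₀ δ s).const_sub 1
  rw [sub_zero] at hlow
  refine tendsto_of_tendsto_of_tendsto_of_le_of_le' hlow tendsto_const_nhds ?_ ?_
  · filter_upwards [eventually_gt_atTop 0] with t ht
    have hT0 : 0 < t ^ (2 / α) := Real.rpow_pos_of_pos ht _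
    refine le_sum_heatKernel hq hT hG o (by positivity) (by positivity) _ fun x hx => ?_
    rw [mem_annulusFinset, not_and_or, not_le, not_le] at hx
    refine one_le_mul_sq_of_le_abs (by positivity) ?_
    have := h ((G.dist o x : ℝ) / t ^ (2 / α))
      (hx.imp (fun h => (div_lt_iff₀ hT0).mpr h) fun h => (lt_div_iff₀ hT0).mpr h)
    calc δ * t ^ (2 / α)
        ≤ |(G.dist o x : ℝ) / t ^ (2 / α) - walkSpeed q * s| * |t ^ (2 / α)| := by
          rw [abs_of_pos hT0]; gcongr
      _ = _ := by
          rw [← abs_mul]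
          congr 1
          field_simp
  · filter_upwards [eventually_gt_atTop 0] with t ht
    exact sum_heatKernel_le_one hG o (by positivity) _

/-- Limit of the mass of the annulus. -/
theorem tendsto_annulusMass (hq : 2 ≤ q) (hT : G.IsTree) (hG : G.IsRegularOfDegree (q + 1))
    (o : V) (hα₀ : 0 < α) (hα₂ : α < 2) {A₁ A₂ : ℝ} (hA₁ : 0 < A₁) :
    Tendsto (annulusMass hG α o A₁ A₂) atTop
      (𝓝 (∫ s in Ioo (A₁ / walkSpeed q) (A₂ / walkSpeed q), subordinatorDensity α 1 s)) := by
  have hv := walkSpeed_pos hq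
  have hf := isSubordinatorDensity_subordinatorDensity hα₀ hα₂ one_pos
  set I := Ioo (A₁ / walkSpeed q) (A₂ / walkSpeed q) with hI
  have hIsub : I ⊆ Ioi 0 := fun s hs => lt_trans (by positivity) hs.1
  have hlim : ∫ s in I, subordinatorDensity α 1 s
      = ∫ s in Ioi (0 : ℝ), I.indicator (subordinatorDensity α 1) s := by
    rw [setIntegral_indicator measurableSet_Ioo, inter_eq_self_of_subset_right hIsub]
  rw [hlim]
  refine Tendsto.congr' (f₁ := fun t => ∫ s in Ioi (0 : ℝ),
    (∑ x ∈ annulusFinset hT.connected α o A₁ A₂ t, heatKernel hG o (t ^ (2 / α) * s) x)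
        * subordinatorDensity α 1 s) ?_ ?_
  · filter_upwards [eventually_gt_atTop 0] with t ht
    exact (annulusMass_eq_integral hT.connected hG o hα₀ hα₂ A₁ A₂ ht).symm
  refine tendsto_integral_filter_of_dominated_convergence (fun s => ‖subordinatorDensity α 1 s‖)
    ?_ ?_ hf.integrableOn.norm ?_
  · refine Eventually.of_forall fun t => ?_
    refine (Continuous.aestronglyMeasurable ?_).mul hf.integrableOn.aestronglyMeasurable
    exact continuous_finsetSum _ fun x _ => (continuous_heatKernel hG o x).comp (by fun_prop)
  · filter_upwards [eventually_gt_atTop 0] with t ht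
    filter_upwards [ae_restrict_mem measurableSet_Ioi] with s hs
    have hs : 0 < s := hs
    rw [norm_mul, Real.norm_of_nonneg (sum_heatKernel_nonneg hG o (by positivity) _)]
    exact mul_le_of_le_one_left (norm_nonneg _) (sum_heatKernel_le_one hG o (by positivity) _)
  -- At the two times with `v s = A₁` or `v s = A₂` Chebyshev decides nothing; they form a null set.
  · have hne : ∀ c : ℝ, ∀ᵐ s ∂(volume.restrict (Ioi (0 : ℝ))), s ≠ c := fun c =>
      ae_restrict_of_ae (Measure.ae_ne volume c)
    filter_upwards [hne (A₁ / walkSpeed q), hne (A₂ / walkSpeed q),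
      ae_restrict_mem measurableSet_Ioi] with s h1 h2 hs
    have hs : 0 < s := hs
    by_cases hsI : s ∈ I
    · have g1 : A₁ < walkSpeed q * s := by
        have := (div_lt_iff₀ hv).mp hsI.1; linarith
      have g2 : walkSpeed q * s < A₂ := by
        have := (lt_div_iff₀ hv).mp hsI.2; linarith
      rw [indicator_of_mem hsI]
      have := (tendsto_sum_heatKernel_one (A₁ := A₁) (A₂ := A₂)
        (δ := min (walkSpeed q * s - A₁) (A₂ - walkSpeed q * s))
        hq hT hG o hα₀ hs (lt_min (by linarith) (by linarith)) fun r hr => by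
          rcases hr with hr | hr
          · rw [abs_of_neg (by linarith)]
            exact (min_le_left _ _).trans (by linarith)
          · rw [abs_of_pos (by linarith)]
            exact (min_le_right _ _).trans (by linarith)).mul_const (subordinatorDensity α 1 s)
      rwa [one_mul] at this
    · rw [indicator_of_notMem hsI]
      have key : ∃ δ, 0 < δ ∧ ∀ r, A₁ ≤ r → r ≤ A₂ → δ ≤ |r - walkSpeed q * s| := by
        rcases lt_or_gt_of_ne h1 with h | h
        · have := (lt_div_iff₀ hv).mp h
          exact ⟨A₁ - walkSpeed q * s, by linarith, fun r hr _ =>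
            le_trans (by linarith) (le_abs_self _)⟩
        · have h3 : A₂ / walkSpeed q < s :=
            lt_of_le_of_ne (not_lt.mp fun h4 => hsI ⟨h, h4⟩) h2.symm
          have := (div_lt_iff₀ hv).mp h3
          exact ⟨walkSpeed q * s - A₂, by linarith, fun r _ hr =>
            le_trans (by linarith) (neg_le_abs _)⟩
      obtain ⟨δ, hδ, hr⟩ := key
      have := (tendsto_sum_heatKernel_zero hq hT hG o hα₀ hs hδ hr).mul_const
        (subordinatorDensity α 1 s)
      rwa [zero_mul] at this

end AnnulusMass

/-! ### Masses of intervals under the stable density -/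

section SubordinatorIntervals

variable {α : ℝ} {f : ℝ → ℝ}

/-- Total mass is `1`, and the disjoint interval `(0, a)` takes a positive share of it. -/
theorem IsSubordinatorDensity.setIntegral_Ioo_lt_one (hα₀ : 0 < α) (hα₂ : α < 2)
    (hf : IsSubordinatorDensity α 1 f) {a c : ℝ} (ha : 0 < a) :
    ∫ u in Ioo a c, f u < 1 := by
  have h1 := hf.setIntegral_Ioo_pos hα₀ hα₂ le_rfl ha
  have hs1 : Ioo 0 a ⊆ Ioi 0 := fun u hu => hu.1
  have hs2 : Ioo a c ⊆ Ioi 0 := fun u hu => ha.trans hu.1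
  have hd : Disjoint (Ioo 0 a) (Ioo a c) :=
    Set.disjoint_left.mpr fun u h1 h2 => lt_asymm h1.2 h2.1
  have h2 := setIntegral_union hd measurableSet_Ioo (hf.integrableOn.mono_set hs1)
    (hf.integrableOn.mono_set hs2)
  have h3 : ∫ u in Ioo 0 a ∪ Ioo a c, f u ≤ ∫ u in Ioi 0, f u := by
    refine setIntegral_mono_set hf.integrableOn ?_ (union_subset hs1 hs2).eventuallyLE
    filter_upwards [ae_restrict_mem measurableSet_Ioi] with u hu using hf.nonneg u hu
  rw [hf.integral_eq_one hα₀] at h3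
  linarith

theorem IsSubordinatorDensity.exists_lt_setIntegral_Ioo (hα₀ : 0 < α)
    (hf : IsSubordinatorDensity α 1 f) {c : ℝ} (hc : c < 1) :
    ∃ a b : ℝ, 0 < a ∧ a < b ∧ c < ∫ u in Ioo a b, f u := by
  -- The upper end `n + 2` keeps the interval nonempty already for `n = 0`.
  have hU : ⋃ n : ℕ, Ioo (1 / ((n : ℝ) + 1)) (n + 2) = Ioi (0 : ℝ) := by
    ext u
    simp only [mem_iUnion, mem_Ioo, mem_Ioi]
    constructor
    · rintro ⟨n, h, -⟩
      exact lt_trans (by positivity) h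
    · intro hu
      obtain ⟨m, hm⟩ := exists_nat_one_div_lt hu
      obtain ⟨k, hk⟩ := exists_nat_gt u
      refine ⟨max m k, lt_of_le_of_lt ?_ hm, hk.trans_le ?_⟩
      · gcongr
        exact le_max_left _ _
      · have : (k : ℝ) ≤ (max m k : ℕ) := by exact_mod_cast le_max_right m k
        linarith
  have hmono : Monotone fun n : ℕ => Ioo (1 / ((n : ℝ) + 1)) (n + 2) := by
    intro m n hmn
    refine Ioo_subset_Ioo ?_ ?_ <;> gcongr
  have h := tendsto_setIntegral_of_monotone (fun _ => measurableSet_Ioo) hmono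
    (f := f) (μ := volume) (by rw [hU]; exact hf.integrableOn)
  rw [hU, hf.integral_eq_one hα₀] at h
  obtain ⟨n, hn⟩ := (h.eventually (lt_mem_nhds hc)).exists
  refine ⟨_, _, by positivity, ?_, hn⟩
  calc 1 / ((n : ℝ) + 1) ≤ 1 := by
        rw [div_le_one (by positivity)]
        linarith [Nat.cast_nonneg (α := ℝ) n]
    _ < n + 2 := by linarith [Nat.cast_nonneg (α := ℝ) n]

theorem IsSubordinatorDensity.exists_setIntegral_Ioo_lt (hf : IsSubordinatorDensity α 1 f) {c : ℝ}
    (hc : 0 < c) : ∃ a b : ℝ, 0 < a ∧ a < b ∧ ∫ u in Ioo a b, f u < c := by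
  -- Open intervals with fixed left end `1` decrease to the empty set, so their masses tend to `0`.
  have hI : ⋂ n : ℕ, Ioo (1 : ℝ) (1 + 1 / ((n : ℝ) + 1)) = ∅ := by
    refine eq_empty_of_forall_notMem fun u hu => ?_
    rw [mem_iInter] at hu
    have h0 := (hu 0).1
    obtain ⟨m, hm⟩ := exists_nat_one_div_lt (sub_pos.mpr h0)
    have := (hu m).2
    linarith
  have hanti : Antitone fun n : ℕ => Ioo (1 : ℝ) (1 + 1 / ((n : ℝ) + 1)) := by
    intro m n hmn
    refine Ioo_subset_Ioo le_rfl ?_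
    gcongr
  have h := tendsto_setIntegral_of_antitone (fun _ => measurableSet_Ioo) hanti
    (f := f) (μ := volume)
    ⟨0, hf.integrableOn.mono_set fun u hu => lt_trans one_pos hu.1⟩
  rw [hI, setIntegral_empty] at h
  obtain ⟨n, hn⟩ := (h.eventually (gt_mem_nhds hc)).exists
  exact ⟨_, _, one_pos, lt_add_of_pos_right _ (by positivity), hn⟩

end SubordinatorIntervals

/-! ### The three assertions -/

theorem theorem3p2 {V : Type*} (G : SimpleGraph V) [G.LocallyFinite] (q : ℕ) (hq : 2 ≤ q)
    (hT : G.IsTree) (hG : G.IsRegularOfDegree (q + 1)) (o : V)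
    (α : ℝ) (hα₀ : 0 < α) (hα₂ : α < 2) :
    (∀ A₁ A₂ : ℝ, 0 < A₁ → A₁ < A₂ →
      ∃ c₁ c₂ : ℝ, 0 < c₁ ∧ c₁ < c₂ ∧ c₂ < 1 ∧
        ∀ᶠ t : ℝ in atTop,
          c₁ < annulusMass hG α o A₁ A₂ t ∧ annulusMass hG α o A₁ A₂ t < c₂) ∧
    (∀ c₁ : ℝ, 0 < c₁ → c₁ < 1 →
      ∃ A₁ A₂ : ℝ, 0 < A₁ ∧ A₁ < A₂ ∧ ∃ c₂ : ℝ, c₁ < c₂ ∧ c₂ < 1 ∧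
        ∀ᶠ t : ℝ in atTop,
          c₁ < annulusMass hG α o A₁ A₂ t ∧ annulusMass hG α o A₁ A₂ t < c₂) ∧
    (∀ c₂ : ℝ, 0 < c₂ → c₂ < 1 →
      ∃ A₁ A₂ : ℝ, 0 < A₁ ∧ A₁ < A₂ ∧ ∃ c₁ : ℝ, 0 < c₁ ∧ c₁ < c₂ ∧
        ∀ᶠ t : ℝ in atTop,
          c₁ < annulusMass hG α o A₁ A₂ t ∧ annulusMass hG α o A₁ A₂ t < c₂) := by
  have hv := walkSpeed_pos hq
  have hf := isSubordinatorDensity_subordinatorDensity hα₀ hα₂ one_pos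
  have hev : ∀ {A₁ A₂ c₁ c₂ : ℝ}, 0 < A₁ →
      c₁ < ∫ s in Ioo (A₁ / walkSpeed q) (A₂ / walkSpeed q), subordinatorDensity α 1 s →
      ∫ s in Ioo (A₁ / walkSpeed q) (A₂ / walkSpeed q), subordinatorDensity α 1 s < c₂ →
      ∀ᶠ t : ℝ in atTop,
        c₁ < annulusMass hG α o A₁ A₂ t ∧ annulusMass hG α o A₁ A₂ t < c₂ :=
    fun hA₁ h1 h2 => (tendsto_annulusMass hq hT hG o hα₀ hα₂ hA₁).eventually
      ((lt_mem_nhds h1).and (gt_mem_nhds h2))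
  have hpos : ∀ {a b : ℝ}, 0 < a → a < b → 0 < ∫ s in Ioo a b, subordinatorDensity α 1 s :=
    fun ha hab => hf.setIntegral_Ioo_pos hα₀ hα₂ ha.le hab
  have hlt : ∀ {a b : ℝ}, 0 < a → ∫ s in Ioo a b, subordinatorDensity α 1 s < 1 :=
    fun ha => hf.setIntegral_Ioo_lt_one hα₀ hα₂ ha
  refine ⟨fun A₁ A₂ hA₁ hA => ?_, fun c₁ hc₁ hc₁' => ?_, fun c₂ hc₂ hc₂' => ?_⟩
  · have h1 := hpos (div_pos hA₁ hv) (div_lt_div_of_pos_right hA hv)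
    have h2 := hlt (b := A₂ / walkSpeed q) (div_pos hA₁ hv)
    obtain ⟨c₁, hc₁, hc₁'⟩ := exists_between h1
    obtain ⟨c₂, hc₂, hc₂'⟩ := exists_between h2
    exact ⟨c₁, c₂, hc₁, hc₁'.trans hc₂, hc₂', hev hA₁ hc₁' hc₂⟩
  · obtain ⟨a, b, ha, hab, hc⟩ := hf.exists_lt_setIntegral_Ioo hα₀ hc₁'
    obtain ⟨c₂, hc₂, hc₂'⟩ := exists_between (hlt (b := b) ha)
    -- The factor `v` undoes the division by `v` in the limit interval.
    refine ⟨a * walkSpeed q, b * walkSpeed q, by positivity, by gcongr, c₂, hc.trans hc₂, hc₂',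
      hev (by positivity) ?_ ?_⟩ <;>
    rwa [mul_div_cancel_right₀ _ hv.ne', mul_div_cancel_right₀ _ hv.ne']
  · obtain ⟨a, b, ha, hab, hc⟩ := hf.exists_setIntegral_Ioo_lt hc₂
    obtain ⟨c₁, hc₁, hc₁'⟩ := exists_between (hpos ha hab)
    refine ⟨a * walkSpeed q, b * walkSpeed q, by positivity, by gcongr, c₁, hc₁, hc₁'.trans hc,
      hev (by positivity) ?_ ?_⟩ <;>
    rwa [mul_div_cancel_right₀ _ hv.ne', mul_div_cancel_right₀ _ hv.ne']
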